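/- Let $M$ be a Riemann surface, $\omega$ a positive continuous volume form on $M$, $E\to M$ a holomorphic vector bundle with a continuous Hermitian metric $h$, and $D=\sum_p m_p\,p$ a divisor on $M$ (with locally finite support). Put $D_+=\sum_{m_p>0}m_p\,p$ and $D_-=\sum_{m_p<0}m_p\,p$. For a meromorphic section $s$ of a holomorphic vector bundle, $\operatorname{ord}_p s$ denotes the minimum of the orders at $p$ of its coordinate functions in a local holomorphic frame, and $\operatorname{div}(s)=\sum_p(\operatorname{ord}_p s)\,p$ (with $\operatorname{ord}_p s=+\infty$ if $s$ vanishes identically near $p$). For an open set $U\subseteq M$, a discrete closed set $\Sigma\subset U$ and a positive continuous volume form $\rho$ on $U\setminus\Sigma$, let $A^2(U,\rho,E,h)$ be the space of holomorphic sections $s$ of $E$ over $U$ with $\|s\|^2:=\int_{U\setminus\Sigma}h(s,s)\,\rho<\infty$. For an effective divisor $D'$ and $\Sigma=\emptyset$ let $A^2_{D'}(U,\rho,E,h)$ be the subspace of those $s\in A^2(U,\rho,E,h)$ with $\operatorname{div}(s)\ge D'$ on $U$. Let $L_D$ be the holomorphic line bundle associated with $D$, that is, a holomorphic line bundle with a meromorphic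 section $s_D$ such that $\operatorname{div}(s_D)=D$, and let $\kappa$ be a continuous Hermitian metric on $L_D$. Put $\rho_D:=\kappa(s_D,s_D)\,\omega$, a positive continuous volume form on $M\setminus\operatorname{supp}(D)$; the space $A^2(M,\rho_D,E,h)$ is taken with $\Sigma=\operatorname{supp}(D)$. 1. Suppose $D\le 0$. Then every $s\in A^2(M,\rho_D,E,h)$ satisfies $\operatorname{div}(s)\ge -D$, and $$\Phi_-:A^2(M,\rho_D,E,h)\to A^2(M,\omega,E\otimes L_D,h\otimes\kappa),\qquad s\mapsto s\otimes s_D$$ (extended holomorphically across $\operatorname{supp}(D)$) is a surjective linear isometry. 2. Suppose $D\ge 0$. Then $$\Phi_+:A^2(M,\rho_D,E,h)\to A^2_D(M,\omega,E\otimes L_D,h\otimes\kappa),\qquad s\mapsto s\otimes s_D$$ is a surjective linear isometry. 3. Let $D$ be arbitrary. Let $L_{D_\pm}$ be the line bundles associated with $D_\pm$, with meromorphic sections $s_\pm$ such that $\operatorname{div}(s_\pm)=D_\pm$ and continuous Hermitian metrics $\kappa_\pm$; put $K_-=\kappa_-(s_-,s_-)$, and take $L_D=L_{D_+}\otimes L_{D_-}$,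 $s_D=s_+\otimes s_-$, $\kappa=\kappa_+\otimes\kappa_-$, so that $\rho_D=\kappa(s_D,s_D)\,\omega=\kappa_+(s_+,s_+)\,\kappa_-(s_-,s_-)\,\omega$. Then $$\Phi:A^2(M,\rho_D,E,h)\to A^2_{D_+}\bigl(M\setminus\operatorname{supp}(D_-),\,K_-\omega,\,E\otimes L_{D_+},\,h\otimes\kappa_+\bigr),\qquad s\mapsto (s\otimes s_+)\big|_{M\setminus\operatorname{supp}(D_-)}$$ is a surjective linear isometry. -/

import Mathlib

set_option linter.unusedSectionVars false

open Bundle MeasureTheory TopologicalSpace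
open scoped Manifold ContDiff TensorProduct ENNReal ComplexConjugate

noncomputable section

/-! ### The tensor product of a vector bundle with a line bundle -/

section Tensor

variable {M : Type*} (F : Type*)
  (E : M → Type*) [∀ x, AddCommGroup (E x)] [∀ x, Module ℂ (E x)]
  (L : M → Type*) [∀ x, AddCommGroup (L x)] [∀ x, Module ℂ (L x)]

/-- The fibres `E x ⊗ L x` of the tensor product of a vector bundle `E` with model fibre `F` and
a line bundle `L` (with model fibre `ℂ`). The model fibre of the tensor product is `F ≅ F ⊗ ℂ`. -/
def TensorLine (_F : Type*) (E : M → Type*) [∀ x, AddCommGroup (E x)] [∀ x, Module ℂ (E x)]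
    (L : M → Type*) [∀ x, AddCommGroup (L x)] [∀ x, Module ℂ (L x)] (x : M) : Type _ :=
  E x ⊗[ℂ] L x

instance (x : M) : AddCommGroup (TensorLine F E L x) :=
  inferInstanceAs (AddCommGroup (E x ⊗[ℂ] L x))

instance (x : M) : Module ℂ (TensorLine F E L x) :=
  inferInstanceAs (Module ℂ (E x ⊗[ℂ] L x))

variable {E L}

/-- The pointwise tensor product `v ⊗ w` as an element of the fibre of `E ⊗ L`. -/
def TensorLine.tmul {x : M} (v : E x) (w : L x) : TensorLine F E L x := v ⊗ₜ[ℂ] w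

theorem TensorLine.induction {x : M} {P : TensorLine F E L x → Prop} (h0 : P 0)
    (ht : ∀ v w, P (TensorLine.tmul F v w)) (ha : ∀ s t, P s → P t → P (s + t))
    (t : TensorLine F E L x) : P t :=
  TensorProduct.induction_on (motive := P) t h0 ht ha

variable [NormedAddCommGroup F] [NormedSpace ℂ F]
  [TopologicalSpace M] [TopologicalSpace (TotalSpace F E)]
  [TopologicalSpace (TotalSpace ℂ L)]
  [∀ x, TopologicalSpace (E x)] [∀ x, TopologicalSpace (L x)]
  (e : Trivialization F (π F E)) (l : Trivialization ℂ (π ℂ L))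

variable {F}

/-- The coordinate map `v ⊗ w ↦ l(w) • e(v)` on the fibre of `E ⊗ L` given by trivializations
`e` of `E` and `l` of `L`. -/
def TensorLine.coord [e.IsLinear ℂ] [l.IsLinear ℂ] (x : M) : TensorLine F E L x →ₗ[ℂ] F :=
  (TensorProduct.rid ℂ F).toLinearMap ∘ₗ
    TensorProduct.map (e.linearMapAt ℂ x) (l.linearMapAt ℂ x)

theorem TensorLine.coord_tmul [e.IsLinear ℂ] [l.IsLinear ℂ] (x : M) (v : E x) (w : L x) :
    TensorLine.coord e l x (TensorLine.tmul F v w) = l.linearMapAt ℂ x w • e.linearMapAt ℂ x v := by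
  change TensorProduct.rid ℂ F
    (TensorProduct.map (e.linearMapAt ℂ x) (l.linearMapAt ℂ x) (v ⊗ₜ[ℂ] w)) = _
  rw [TensorProduct.map_tmul, TensorProduct.rid_tmul]

theorem TensorLine.tmul_coord [e.IsLinear ℂ] [l.IsLinear ℂ] {x : M} (hx : x ∈ e.baseSet)
    (hx' : x ∈ l.baseSet) (t : TensorLine F E L x) :
    TensorLine.tmul F (e.symm x (TensorLine.coord e l x t)) (l.symm x 1) = t := by
  induction t using TensorLine.induction F with
  | h0 =>
    rw [map_zero, ← e.symmₗ_apply (R := ℂ) hx]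
    simp only [TensorLine.tmul, map_zero]
    exact TensorProduct.zero_tmul _ _
  | ht v w =>
    rw [TensorLine.coord_tmul]
    simp only [TensorLine.tmul]
    rw [← e.symmₗ_apply (R := ℂ) hx, map_smul, TensorProduct.smul_tmul,
      ← l.symmₗ_apply (R := ℂ) hx', ← map_smul, smul_eq_mul, mul_one,
      e.symmₗ_linearMapAt hx, l.symmₗ_linearMapAt hx']
  | ha s t hs ht =>
    conv_rhs => rw [← hs, ← ht]
    rw [map_add, ← e.symmₗ_apply (R := ℂ) hx, ← e.symmₗ_apply (R := ℂ) hx,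
      ← e.symmₗ_apply (R := ℂ) hx, map_add]
    simp only [TensorLine.tmul]
    exact TensorProduct.add_tmul _ _ _

theorem TensorLine.coord_symm [e.IsLinear ℂ] [l.IsLinear ℂ] {x : M} (hx : x ∈ e.baseSet)
    (hx' : x ∈ l.baseSet) (u : F) (c : ℂ) :
    TensorLine.coord e l x (TensorLine.tmul F (e.symm x u) (l.symm x c)) = c • u := by
  rw [TensorLine.coord_tmul, ← e.symmₗ_apply (R := ℂ) hx, ← l.symmₗ_apply (R := ℂ) hx',
    e.linearMapAt_symmₗ hx, l.linearMapAt_symmₗ hx']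

/-- The local trivialization of `E ⊗ L` induced by trivializations of `E` and `L`. -/
def TensorLine.pretrivialization [e.IsLinear ℂ] [l.IsLinear ℂ] :
    Pretrivialization F (π F (TensorLine F E L)) where
  toFun p := ⟨p.1, TensorLine.coord e l p.1 p.2⟩
  invFun p := ⟨p.1, TensorLine.tmul F (e.symm p.1 p.2) (l.symm p.1 1)⟩
  source := TotalSpace.proj ⁻¹' (e.baseSet ∩ l.baseSet)
  target := (e.baseSet ∩ l.baseSet) ×ˢ Set.univ
  map_source' := fun ⟨_, _⟩ h ↦ ⟨h, Set.mem_univ _⟩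
  map_target' := fun ⟨_, _⟩ h ↦ h.1
  left_inv' := fun ⟨x, t⟩ ⟨h₁, h₂⟩ ↦ by
    simp only [TotalSpace.mk_inj]
    exact TensorLine.tmul_coord e l h₁ h₂ t
  right_inv' := fun ⟨x, u⟩ ⟨⟨h₁, h₂⟩, _⟩ ↦ by
    simp only [Prod.mk_right_inj]
    rw [TensorLine.coord_symm e l h₁ h₂, one_smul]
  open_target := (e.open_baseSet.inter l.open_baseSet).prod isOpen_univ
  baseSet := e.baseSet ∩ l.baseSet
  open_baseSet := e.open_baseSet.inter l.open_baseSet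
  source_eq := rfl
  target_eq := rfl
  proj_toFun _ _ := rfl

theorem TensorLine.pretrivialization_symm [e.IsLinear ℂ] [l.IsLinear ℂ] {x : M}
    (hx : x ∈ e.baseSet ∩ l.baseSet) (u : F) :
    (TensorLine.pretrivialization e l).symm x u = TensorLine.tmul F (e.symm x u) (l.symm x 1) := by
  rw [Pretrivialization.symm_apply]
  · rfl
  · exact hx

variable [FiberBundle F E] [VectorBundle ℂ F E] [FiberBundle ℂ L] [VectorBundle ℂ ℂ L]

instance (x : M) : TopologicalSpace (TensorLine F E L x) :=
  TopologicalSpace.induced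
    (TensorLine.coord (trivializationAt F E x) (trivializationAt ℂ L x) x) inferInstance

/-- The coordinate changes of `E ⊗ L`: products of those of `E` and `L`. -/
def TensorLine.coordChange (e e' : Trivialization F (π F E)) (l l' : Trivialization ℂ (π ℂ L))
    [e.IsLinear ℂ] [e'.IsLinear ℂ] [l.IsLinear ℂ] [l'.IsLinear ℂ] (x : M) : F →L[ℂ] F :=
  ((l.coordChangeL ℂ l' x : ℂ →L[ℂ] ℂ) 1) • (e.coordChangeL ℂ e' x : F →L[ℂ] F)

theorem TensorLine.coordChange_apply (e e' : Trivialization F (π F E))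
    (l l' : Trivialization ℂ (π ℂ L))
    [e.IsLinear ℂ] [e'.IsLinear ℂ] [l.IsLinear ℂ] [l'.IsLinear ℂ] {x : M}
    (hx : x ∈ (e.baseSet ∩ l.baseSet) ∩ (e'.baseSet ∩ l'.baseSet)) (u : F) :
    TensorLine.coordChange e e' l l' x u =
      (TensorLine.pretrivialization e' l'
        ⟨x, (TensorLine.pretrivialization e l).symm x u⟩).2 := by
  rw [TensorLine.pretrivialization_symm e l hx.1]
  change _ = TensorLine.coord e' l' x _
  rw [TensorLine.coord_tmul, e'.coe_linearMapAt_of_mem hx.2.1, l'.coe_linearMapAt_of_mem hx.2.2]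
  simp only [TensorLine.coordChange, _root_.smul_apply,
    ContinuousLinearEquiv.coe_coe]
  rw [e.coordChangeL_apply e' ⟨hx.1.1, hx.2.1⟩, l.coordChangeL_apply l' ⟨hx.1.2, hx.2.2⟩]

variable (F E L)

/-- The vector bundle structure of `E ⊗ L`. -/
def TensorLine.vectorPrebundle : VectorPrebundle ℂ F (TensorLine F E L) where
  pretrivializationAtlas :=
    {t | ∃ (e : Trivialization F (π F E)) (l : Trivialization ℂ (π ℂ L))
      (_ : MemTrivializationAtlas e) (_ : MemTrivializationAtlas l),
        t = TensorLine.pretrivialization e l}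
  pretrivialization_linear' := by
    rintro _ ⟨e, l, he, hl, rfl⟩
    exact ⟨fun x _ ↦ (TensorLine.coord e l x).isLinear⟩
  pretrivializationAt x :=
    TensorLine.pretrivialization (trivializationAt F E x) (trivializationAt ℂ L x)
  mem_base_pretrivializationAt x :=
    ⟨mem_baseSet_trivializationAt F E x, mem_baseSet_trivializationAt ℂ L x⟩
  pretrivialization_mem_atlas x :=
    ⟨trivializationAt F E x, trivializationAt ℂ L x, inferInstance, inferInstance, rfl⟩
  exists_coordChange := by
    rintro _ ⟨e, l, he, hl, rfl⟩ _ ⟨e', l', he', hl', rfl⟩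
    refine ⟨TensorLine.coordChange e e' l l', ?_,
      fun x hx u ↦ TensorLine.coordChange_apply e e' l l' hx u⟩
    have h₁ := continuousOn_coordChange ℂ e e'
    have h₂ := continuousOn_coordChange ℂ l l'
    refine ContinuousOn.smul ((h₂.mono ?_).clm_apply continuousOn_const) (h₁.mono ?_)
    · exact fun x hx ↦ ⟨hx.1.2, hx.2.2⟩
    · exact fun x hx ↦ ⟨hx.1.1, hx.2.1⟩
  totalSpaceMk_isInducing := fun b ↦ Topology.isInducing_const_prod.mpr ⟨rfl⟩

instance : TopologicalSpace (TotalSpace F (TensorLine F E L)) :=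
  (TensorLine.vectorPrebundle F E L).totalSpaceTopology

instance : FiberBundle F (TensorLine F E L) :=
  (TensorLine.vectorPrebundle F E L).toFiberBundle

instance : VectorBundle ℂ F (TensorLine F E L) :=
  (TensorLine.vectorPrebundle F E L).toVectorBundle

instance [ChartedSpace ℂ M] [ContMDiffVectorBundle ω F E 𝓘(ℂ)]
    [ContMDiffVectorBundle ω ℂ L 𝓘(ℂ)] :
    (TensorLine.vectorPrebundle F E L).IsContMDiff 𝓘(ℂ) ω where
  exists_contMDiffCoordChange := by
    rintro _ ⟨e, l, he, hl, rfl⟩ _ ⟨e', l', he', hl', rfl⟩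
    refine ⟨TensorLine.coordChange e e' l l', ?_,
      fun x hx u ↦ TensorLine.coordChange_apply e e' l l' hx u⟩
    have h₁ := contMDiffOn_coordChangeL (IB := 𝓘(ℂ)) e e' (n := ω)
    have h₂ := contMDiffOn_coordChangeL (IB := 𝓘(ℂ)) l l' (n := ω)
    refine ContMDiffOn.smul (ContMDiffOn.clm_apply (h₂.mono ?_) contMDiffOn_const) (h₁.mono ?_)
    · exact fun x hx ↦ ⟨hx.1.2, hx.2.2⟩
    · exact fun x hx ↦ ⟨hx.1.1, hx.2.1⟩

instance [ChartedSpace ℂ M] [ContMDiffVectorBundle ω F E 𝓘(ℂ)]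
    [ContMDiffVectorBundle ω ℂ L 𝓘(ℂ)] : ContMDiffVectorBundle ω F (TensorLine F E L) 𝓘(ℂ) :=
  (TensorLine.vectorPrebundle F E L).contMDiffVectorBundle 𝓘(ℂ)

end Tensor

/-! ### Hermitian metrics, sections and their orders -/

section Metric

variable {M : Type*} [TopologicalSpace M]
  (F : Type*) [NormedAddCommGroup F] [NormedSpace ℂ F]
  (E : M → Type*) [∀ x, AddCommGroup (E x)] [∀ x, Module ℂ (E x)]
  [TopologicalSpace (TotalSpace F E)] [∀ x, TopologicalSpace (E x)]
  [FiberBundle F E] [VectorBundle ℂ F E]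

/-- A continuous Hermitian metric on the vector bundle `E`: a positive definite Hermitian form on
every fibre (linear in the second variable), whose coefficients in the local frames of `E` are
continuous. -/
structure HermitianMetric where
  form : ∀ x, E x →ₗ⋆[ℂ] E x →ₗ[ℂ] ℂ
  conj_symm : ∀ x (v w : E x), conj (form x w v) = form x v w
  pos : ∀ x (v : E x), v ≠ 0 → 0 < (form x v v).re
  continuous : ∀ (x₀ : M) (u v : F), ContinuousOn
    (fun x ↦ form x ((trivializationAt F E x₀).symm x u) ((trivializationAt F E x₀).symm x v))
    (trivializationAt F E x₀).baseSet

variable {F E}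

/-- `h(v, v)`, as a real number. -/
def HermitianMetric.normSq (h : HermitianMetric F E) (x : M) (v : E x) : ℝ := (h.form x v v).re

theorem HermitianMetric.normSq_nonneg (h : HermitianMetric F E) (x : M) (v : E x) :
    0 ≤ h.normSq x v := by
  by_cases hv : v = 0
  · simp [HermitianMetric.normSq, hv]
  · exact (h.pos x v hv).le

theorem HermitianMetric.normSq_smul (h : HermitianMetric F E) (x : M) (c : ℂ) (v : E x) :
    h.normSq x (c • v) = ‖c‖ ^ 2 * h.normSq x v := by
  simp only [HermitianMetric.normSq, map_smulₛₗ, LinearMap.smul_apply, smul_eq_mul,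
    RingHom.id_apply]
  rw [← mul_assoc, mul_comm c, ← Complex.normSq_eq_conj_mul_self, Complex.re_ofReal_mul,
    Complex.normSq_eq_norm_sq]

theorem HermitianMetric.normSq_add_le (h : HermitianMetric F E) (x : M) (v w : E x) :
    h.normSq x (v + w) ≤ 2 * h.normSq x v + 2 * h.normSq x w := by
  have := h.normSq_nonneg x (v - w)
  simp only [HermitianMetric.normSq, map_add, map_sub, LinearMap.add_apply, LinearMap.sub_apply,
    Complex.add_re, Complex.sub_re] at *
  linarith

variable {L : M → Type*} [∀ x, AddCommGroup (L x)] [∀ x, Module ℂ (L x)]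
  [TopologicalSpace (TotalSpace ℂ L)] [∀ x, TopologicalSpace (L x)]
  [FiberBundle ℂ L] [VectorBundle ℂ ℂ L]

/-- The sesquilinear form with `(v ⊗ w, v' ⊗ w') ↦ h(v, v') κ(w, w')`. -/
def HermitianMetric.tensorForm (h : HermitianMetric F E) (κ : HermitianMetric ℂ L) (x : M) :
    TensorLine F E L x →ₗ⋆[ℂ] TensorLine F E L x →ₗ[ℂ] ℂ :=
  ((TensorProduct.lift <| TensorProduct.mapBilinear (.id ℂ) (E x) (L x) ℂ ℂ).compr₂
    (.mul' ℂ ℂ)) ∘ₛₗ TensorProduct.map (h.form x) (κ.form x)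

theorem HermitianMetric.tensorForm_tmul (h : HermitianMetric F E) (κ : HermitianMetric ℂ L)
    (x : M) (v v' : E x) (w w' : L x) :
    h.tensorForm κ x (TensorLine.tmul F v w) (TensorLine.tmul F v' w') =
      h.form x v v' * κ.form x w w' := rfl

/-- The metric `h ⊗ κ` on `E ⊗ L`. -/
def HermitianMetric.tensor (h : HermitianMetric F E) (κ : HermitianMetric ℂ L) :
    HermitianMetric F (TensorLine F E L) where
  form := h.tensorForm κ
  conj_symm x v w := by
    have hE := mem_baseSet_trivializationAt F E x
    have hL := mem_baseSet_trivializationAt ℂ L x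
    rw [← TensorLine.tmul_coord _ _ hE hL v, ← TensorLine.tmul_coord _ _ hE hL w,
      HermitianMetric.tensorForm_tmul, HermitianMetric.tensorForm_tmul, map_mul,
      h.conj_symm, κ.conj_symm]
  pos x v hv := by
    have hE := mem_baseSet_trivializationAt F E x
    have hL := mem_baseSet_trivializationAt ℂ L x
    have h1 := TensorLine.tmul_coord _ _ hE hL v
    generalize (trivializationAt F E x).symm x
      (TensorLine.coord (trivializationAt F E x) (trivializationAt ℂ L x) x v) = a at h1
    generalize (trivializationAt ℂ L x).symm x 1 = b at h1
    subst h1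
    have ha : a ≠ 0 := by
      rintro rfl
      exact hv (TensorProduct.zero_tmul _ _)
    have hb : b ≠ 0 := by
      rintro rfl
      exact hv (TensorProduct.tmul_zero _ _)
    have him : (h.form x a a).im = 0 := Complex.conj_eq_iff_im.1 (h.conj_symm x a a)
    rw [HermitianMetric.tensorForm_tmul, Complex.mul_re, him, zero_mul, sub_zero]
    exact mul_pos (h.pos x a ha) (κ.pos x b hb)
  continuous x₀ u v := by
    have h1 := (h.continuous x₀ u v).mono
      (Set.inter_subset_left (t := (trivializationAt ℂ L x₀).baseSet))
    have h2 := (κ.continuous x₀ 1 1).mono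
      (Set.inter_subset_right (s := (trivializationAt F E x₀).baseSet))
    refine (h1.mul h2).congr fun x hx ↦ ?_
    have key : ∀ u : F, (trivializationAt F (TensorLine F E L) x₀).symm x u =
        TensorLine.tmul F ((trivializationAt F E x₀).symm x u)
          ((trivializationAt ℂ L x₀).symm x 1) := fun u ↦
      TensorLine.pretrivialization_symm _ _ hx u
    simp only [key]
    rfl

variable [ChartedSpace ℂ M]

variable (F E) in
/-- The space of holomorphic sections of `E` over the open set `U`. A section over `U` is
encoded as a function on `M` that vanishes outside `U`. -/
def holomorphicSections (U : Opens M) : Submodule ℂ (∀ x, E x) where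
  carrier := {s | (∀ x ∉ U, s x = 0) ∧
    ContMDiffOn 𝓘(ℂ) (𝓘(ℂ).prod 𝓘(ℂ, F)) ω (fun x ↦ TotalSpace.mk' F x (s x)) U}
  add_mem' hs ht := ⟨fun x hx ↦ by simp [hs.1 x hx, ht.1 x hx], hs.2.add_section ht.2⟩
  zero_mem' := ⟨fun _ _ ↦ rfl, (contMDiff_zeroSection ℂ E).contMDiffOn⟩
  smul_mem' c s hs := ⟨fun x hx ↦ by simp [hs.1 x hx], hs.2.const_smul_section⟩

variable (F) in
/-- The section `s` near `p`, read in the local coordinate and the local frame at `p`. -/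
def localRep (s : ∀ x, E x) (p : M) : ℂ → F := fun z ↦
  (trivializationAt F E p ⟨(chartAt ℂ p).symm z, s ((chartAt ℂ p).symm z)⟩).2

variable (F) in
/-- The order of a meromorphic section at `p` (`⊤` if it vanishes identically near `p`). -/
def ordAt (s : ∀ x, E x) (p : M) : WithTop ℤ :=
  meromorphicOrderAt (localRep F s p) (chartAt ℂ p p)

variable (F) in
/-- Meromorphic sections of `E` over `M`. The value at a pole carries no information; at all
other points `s` is holomorphic. -/
def IsMeromorphicSection (s : ∀ x, E x) : Prop :=
  ∀ p, MeromorphicAt (localRep F s p) (chartAt ℂ p p) ∧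
    (0 ≤ ordAt F s p →
      ContMDiffAt 𝓘(ℂ) (𝓘(ℂ).prod 𝓘(ℂ, F)) ω (fun x ↦ TotalSpace.mk' F x (s x)) p)

theorem meromorphicAt_localRep {s : ∀ x, E x} {p : M}
    (hs : ContMDiffAt 𝓘(ℂ) (𝓘(ℂ).prod 𝓘(ℂ, F)) ω (fun x ↦ TotalSpace.mk' F x (s x)) p) :
    MeromorphicAt (localRep F s p) (chartAt ℂ p p) := by
  rw [contMDiffAt_section] at hs
  have h := (contMDiffAt_iff.1 hs).2
  simp only [mfld_simps] at h
  rw [contDiffWithinAt_univ] at h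
  exact (ContDiffAt.analyticAt h).meromorphicAt

theorem localRep_add_smul (s t : ∀ x, E x) (c : ℂ) (p : M) :
    localRep F (s + c • t) p =ᶠ[nhds (chartAt ℂ p p)] localRep F s p + c • localRep F t p := by
  have hc : ContinuousAt (chartAt ℂ p).symm (chartAt ℂ p p) :=
    (chartAt ℂ p).continuousAt_symm (mem_chart_target ℂ p)
  have hp : (trivializationAt F E p).baseSet ∈ nhds ((chartAt ℂ p).symm (chartAt ℂ p p)) := by
    rw [(chartAt ℂ p).left_inv (mem_chart_source ℂ p)]
    exact (trivializationAt F E p).open_baseSet.mem_nhds (mem_baseSet_trivializationAt F E p)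
  filter_upwards [hc.preimage_mem_nhds hp] with z hz
  have hl := (trivializationAt F E p).linear ℂ hz
  simp only [localRep, Pi.add_apply, Pi.smul_apply]
  rw [hl.map_add, hl.map_smul]

theorem ordAt_zero (p : M) : ordAt F (0 : ∀ x, E x) p = ⊤ := by
  have h := localRep_add_smul (F := F) (0 : ∀ x, E x) 0 (-1) p
  rw [smul_zero, add_zero] at h
  refine meromorphicOrderAt_eq_top_iff.2 ?_
  filter_upwards [h.filter_mono nhdsWithin_le_nhds] with z hz
  rw [hz]
  simp

theorem le_ordAt_add_smul {s t : ∀ x, E x} {p : M}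
    (hs : MeromorphicAt (localRep F s p) (chartAt ℂ p p))
    (ht : MeromorphicAt (localRep F t p) (chartAt ℂ p p)) (c : ℂ) :
    min (ordAt F s p) (ordAt F t p) ≤ ordAt F (s + c • t) p := by
  have h1 : ordAt F (s + c • t) p =
      meromorphicOrderAt (localRep F s p + c • localRep F t p) (chartAt ℂ p p) :=
    meromorphicOrderAt_congr ((localRep_add_smul s t c p).filter_mono nhdsWithin_le_nhds)
  have h2 : meromorphicOrderAt (localRep F t p) (chartAt ℂ p p) ≤
      meromorphicOrderAt (c • localRep F t p) (chartAt ℂ p p) := by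
    have := meromorphicOrderAt_smul (f := fun _ : ℂ ↦ c) (MeromorphicAt.const c _) ht
    have e : (fun _ : ℂ ↦ c) • localRep F t p = c • localRep F t p := rfl
    rw [e] at this
    rw [this]
    refine le_add_of_nonneg_left ?_
    exact AnalyticAt.meromorphicOrderAt_nonneg analyticAt_const
  rw [h1]
  refine le_trans (min_le_min_left _ h2) (meromorphicOrderAt_add hs ?_)
  exact (MeromorphicAt.const c _).smul ht

end Metric

/-! ### Volume forms and their integrals -/

section Volume

variable (M : Type*) [TopologicalSpace M] [ChartedSpace ℂ M]

/-- Real 2-forms on `M` (without regularity). -/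
abbrev TwoForm := ∀ x : M, (TangentSpace 𝓘(ℂ) x) [⋀^Fin 2]→ₗ[ℝ] ℝ

variable {M}

/-- The coefficient `f` of the 2-form `θ = f dx ∧ dy = f (i/2) dz ∧ dz̄` in the holomorphic
coordinate `z = x + i y` given by the chart `φ`. -/
def TwoForm.density (θ : TwoForm M) (φ : OpenPartialHomeomorph M ℂ) (z : ℂ) : ℝ :=
  θ (φ.symm z) ![mfderiv 𝓘(ℂ) 𝓘(ℂ) φ.symm z (1 : ℂ), mfderiv 𝓘(ℂ) 𝓘(ℂ) φ.symm z Complex.I]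

/-- `θ` is a positive continuous volume form on `M`. -/
def TwoForm.IsPositiveContinuous (θ : TwoForm M) : Prop :=
  ∀ φ ∈ atlas ℂ M, ContinuousOn (θ.density φ) φ.target ∧ ∀ z ∈ φ.target, 0 < θ.density φ z

variable [MeasurableSpace M]

/-- The measure `f dx dy` given by `θ = f dx ∧ dy` in the chart `φ`, transported to `M`. -/
def TwoForm.chartMeasure (θ : TwoForm M) (φ : OpenPartialHomeomorph M ℂ) : Measure M :=
  ((volume.restrict φ.target).withDensity fun z ↦ ENNReal.ofReal (θ.density φ z)).map φ.symm

/-- The measure on `M` given by integration of the positive 2-form `θ`. The measures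
`f dx dy` on the chart domains agree on overlaps, and the measure obtained by gluing them is the
smallest one that dominates all of them. -/
def TwoForm.measure (θ : TwoForm M) : Measure M :=
  ⨆ φ : atlas ℂ M, θ.chartMeasure φ.1

end Volume

/-! ### Bergman spaces -/

section Bergman

variable {M : Type*} [TopologicalSpace M] [ChartedSpace ℂ M] [MeasurableSpace M] [BorelSpace M]
  {F : Type*} [NormedAddCommGroup F] [NormedSpace ℂ F]
  {E : M → Type*} [∀ x, AddCommGroup (E x)] [∀ x, Module ℂ (E x)]
  [TopologicalSpace (TotalSpace F E)] [∀ x, TopologicalSpace (E x)]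
  [FiberBundle F E] [VectorBundle ℂ F E]

/-- `∫_{U ∖ S} h(s, s) ρ`. -/
def l2NormSq (U : Opens M) (S : Set M) (ρ : TwoForm M) (h : HermitianMetric F E)
    (s : ∀ x, E x) : ℝ≥0∞ :=
  ∫⁻ x in (U : Set M) \ S, ENNReal.ofReal (h.normSq x (s x)) ∂ρ.measure

/-- The `L²` norm of a section. -/
def l2Norm (U : Opens M) (S : Set M) (ρ : TwoForm M) (h : HermitianMetric F E)
    (s : ∀ x, E x) : ℝ :=
  √(l2NormSq U S ρ h s).toReal

theorem continuousOn_normSq [FiniteDimensional ℂ F] (U : Opens M) (h : HermitianMetric F E)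
    {s : ∀ x, E x} (hs : s ∈ holomorphicSections F E U) :
    ContinuousOn (fun x ↦ h.normSq x (s x)) U := by
  intro x₀ hx₀
  have hc := (contMDiffWithinAt_section.1 (hs.2 x₀ hx₀)).continuousWithinAt
  have hb : (trivializationAt F E x₀).baseSet ∈ nhds x₀ :=
    (trivializationAt F E x₀).open_baseSet.mem_nhds (mem_baseSet_trivializationAt F E x₀)
  let b := Module.finBasis ℂ F
  let f : M → F := fun x ↦ (trivializationAt F E x₀ ⟨x, s x⟩).2
  have hf : ∀ i, ContinuousWithinAt (fun x ↦ b.repr (f x) i) U x₀ := fun i ↦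
    ((LinearMap.continuous_of_finiteDimensional (b.coord i)).continuousAt).comp_continuousWithinAt
      hc
  have hh : ∀ i j, ContinuousWithinAt (fun x ↦ h.form x
      ((trivializationAt F E x₀).symm x (b i)) ((trivializationAt F E x₀).symm x (b j))) U x₀ :=
    fun i j ↦ ((h.continuous x₀ (b i) (b j)).continuousAt hb).continuousWithinAt
  have hsum : ContinuousWithinAt (fun x ↦ (∑ i, ∑ j, conj (b.repr (f x) i) * (b.repr (f x) j *
      h.form x ((trivializationAt F E x₀).symm x (b i))
        ((trivializationAt F E x₀).symm x (b j)))).re) U x₀ := by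
    refine Complex.continuous_re.continuousAt.comp_continuousWithinAt ?_
    refine tendsto_finsetSum _ fun i _ ↦ tendsto_finsetSum _ fun j _ ↦ ?_
    exact (Complex.continuous_conj.continuousAt.comp_continuousWithinAt (hf i)).mul
      ((hf j).mul (hh i j))
  have key : ∀ x ∈ (trivializationAt F E x₀).baseSet, h.normSq x (s x) =
      (∑ i, ∑ j, conj (b.repr (f x) i) * (b.repr (f x) j *
      h.form x ((trivializationAt F E x₀).symm x (b i))
        ((trivializationAt F E x₀).symm x (b j)))).re := by
    intro x hx
    have h1 : s x = ∑ i, b.repr (f x) i • (trivializationAt F E x₀).symm x (b i) := by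
      have h2 : s x = (trivializationAt F E x₀).symm x (f x) :=
        ((trivializationAt F E x₀).symm_apply_apply_mk hx (s x)).symm
      conv_lhs => rw [h2, ← b.sum_repr (f x)]
      rw [← (trivializationAt F E x₀).symmₗ_apply (R := ℂ) hx, map_sum]
      refine Finset.sum_congr rfl fun i _ ↦ ?_
      rw [map_smul, (trivializationAt F E x₀).symmₗ_apply (R := ℂ) hx]
    simp only [HermitianMetric.normSq]
    congr 1
    conv_lhs => rw [h1]
    simp only [map_sum, LinearMap.sum_apply, map_smulₛₗ, LinearMap.smul_apply, smul_eq_mul,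
      Finset.mul_sum, RingHom.id_apply]
    rw [Finset.sum_comm]
    exact Finset.sum_congr rfl fun i _ ↦ Finset.sum_congr rfl fun j _ ↦ by ring
  refine hsum.congr_of_eventuallyEq ?_ (key x₀ (mem_baseSet_trivializationAt F E x₀))
  exact Filter.eventually_of_mem (mem_nhdsWithin_of_mem_nhds hb) key

theorem l2NormSq_add_lt_top [FiniteDimensional ℂ F] {U : Opens M} {S : Set M} {ρ : TwoForm M}
    {h : HermitianMetric F E} {s t : ∀ x, E x} (hs' : s ∈ holomorphicSections F E U)
    (hs : l2NormSq U S ρ h s < ⊤) (ht : l2NormSq U S ρ h t < ⊤) :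
    l2NormSq U S ρ h (s + t) < ⊤ := by
  have hm : AEMeasurable (fun x ↦ ENNReal.ofReal (h.normSq x (s x)))
      (ρ.measure.restrict ((U : Set M) \ S)) :=
    (((continuousOn_normSq U h hs').aemeasurable U.isOpen.measurableSet).mono_measure
      (Measure.restrict_mono Set.sdiff_subset le_rfl)).ennreal_ofReal
  calc l2NormSq U S ρ h (s + t)
      ≤ ∫⁻ x in (U : Set M) \ S, (2 * ENNReal.ofReal (h.normSq x (s x)) +
          2 * ENNReal.ofReal (h.normSq x (t x))) ∂ρ.measure := by
        refine lintegral_mono fun x ↦ ?_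
        have h2 : (2 : ℝ≥0∞) = ENNReal.ofReal 2 := by simp
        rw [h2, ← ENNReal.ofReal_mul zero_le_two, ← ENNReal.ofReal_mul zero_le_two,
          ← ENNReal.ofReal_add (mul_nonneg zero_le_two (h.normSq_nonneg _ _))
            (mul_nonneg zero_le_two (h.normSq_nonneg _ _))]
        exact ENNReal.ofReal_le_ofReal (h.normSq_add_le x (s x) (t x))
    _ = 2 * l2NormSq U S ρ h s + 2 * l2NormSq U S ρ h t := by
        rw [lintegral_add_left' (hm.const_mul 2), lintegral_const_mul' _ _ (by simp),
          lintegral_const_mul' _ _ (by simp)]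
        rfl
    _ < ⊤ := ENNReal.add_lt_top.2 ⟨ENNReal.mul_lt_top (by simp) hs, ENNReal.mul_lt_top (by simp) ht⟩

theorem l2NormSq_smul (U : Opens M) (S : Set M) (ρ : TwoForm M)
    (h : HermitianMetric F E) (c : ℂ) (s : ∀ x, E x) :
    l2NormSq U S ρ h (c • s) = ENNReal.ofReal (‖c‖ ^ 2) * l2NormSq U S ρ h s := by
  unfold l2NormSq
  rw [← lintegral_const_mul' _ _ (by simp)]
  refine lintegral_congr fun x ↦ ?_
  rw [Pi.smul_apply, h.normSq_smul, ENNReal.ofReal_mul (by positivity)]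

/-- The Bergman space `A²(U, ρ, E, h)` of a volume form `ρ` on `U ∖ S`. -/
def bergman [FiniteDimensional ℂ F] (U : Opens M) (S : Set M) (ρ : TwoForm M)
    (h : HermitianMetric F E) : Submodule ℂ (∀ x, E x) where
  carrier := {s | s ∈ holomorphicSections F E U ∧ l2NormSq U S ρ h s < ⊤}
  add_mem' hs ht := ⟨add_mem hs.1 ht.1, l2NormSq_add_lt_top hs.1 hs.2 ht.2⟩
  zero_mem' := ⟨zero_mem _, by simp [l2NormSq, HermitianMetric.normSq]⟩
  smul_mem' c s hs := ⟨Submodule.smul_mem _ c hs.1, by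
    change l2NormSq U S ρ h (c • s) < ⊤
    rw [l2NormSq_smul]
    exact ENNReal.mul_lt_top (by simp) hs.2⟩

theorem meromorphicAt_of_mem {U : Opens M} {s : ∀ x, E x} (hs : s ∈ holomorphicSections F E U)
    {p : M} (hp : p ∈ U) : MeromorphicAt (localRep F s p) (chartAt ℂ p p) :=
  meromorphicAt_localRep ((hs.2 p hp).contMDiffAt (U.isOpen.mem_nhds hp))

/-- The subspace `A²_D(U, ω, E, h)` of the sections `s` in `A²(U, ω, E, h)` with
`div s ≥ D` on `U`. -/
def bergmanDiv [FiniteDimensional ℂ F] (D : Function.locallyFinsupp M ℤ) (U : Opens M)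
    (ρ : TwoForm M) (h : HermitianMetric F E) : Submodule ℂ (∀ x, E x) where
  carrier := {s | s ∈ bergman U ∅ ρ h ∧ ∀ p ∈ U, (D p : WithTop ℤ) ≤ ordAt F s p}
  add_mem' {s t} hs ht := ⟨add_mem hs.1 ht.1, fun p hp ↦ by
    have := le_ordAt_add_smul (meromorphicAt_of_mem hs.1.1 hp) (meromorphicAt_of_mem ht.1.1 hp) 1
    rw [one_smul] at this
    exact (le_min (hs.2 p hp) (ht.2 p hp)).trans this⟩
  zero_mem' := ⟨zero_mem _, fun p _ ↦ by rw [ordAt_zero]; exact le_top⟩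
  smul_mem' c s hs := ⟨Submodule.smul_mem _ c hs.1, fun p hp ↦ by
    have := le_ordAt_add_smul (meromorphicAt_of_mem (zero_mem (holomorphicSections F E U)) hp)
      (meromorphicAt_of_mem hs.1.1 hp) c
    rw [ordAt_zero, min_eq_right le_top, zero_add] at this
    exact (hs.2 p hp).trans this⟩

/-- The form `κ(s, s) θ`. -/
def HermitianMetric.weight (κ : HermitianMetric F E) (s : ∀ x, E x) (θ : TwoForm M) : TwoForm M :=
  fun x ↦ κ.normSq x (s x) • θ x

/-- The complement of the support of a divisor, an open set. -/
def complSupport [T2Space M] (D : Function.locallyFinsupp M ℤ) : Opens M :=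
  ⟨D.supportᶜ, (D.closedSupport isClosed_univ).isOpen_compl⟩

end Bergman

end

open Filter Topology

/-! ### Square integrable holomorphic functions on a punctured disc -/

section RemovableSingularity

variable {F : Type*} [NormedAddCommGroup F] [NormedSpace ℂ F] [CompleteSpace F]

/-! Off the support of the divisor, tensoring with a nonvanishing section `w` of a line bundle
multiplies the squared pointwise norm by `κ(w, w)`, which is exactly the factor put into the
weighted volume form. The support is closed and discrete, hence null, so multiplication by `w`
preserves norms (`l2NormSq_tmul`, `l2NormSq_complSupport_tmul`). What remains is to see which
holomorphic sections correspond to each other.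

The analytic input is that a square integrable holomorphic function on a punctured disc extends
across the puncture (`exists_analyticAt_of_lintegral_enorm_sq_lt_top`): the mean value inequality on
discs of radius `|z - c| / 2` gives `|z - c| ‖f z‖ → 0`, and Riemann's theorem applies. Near a point
the volume density and the metric in a frame are bounded below, so the same holds for sections
(`exists_analyticAt_localRep_of_lintegral_lt_top`). Hence `s ⊗ s_D` extends whenever `s` has finite
weighted norm, and its order being nonnegative says `ord s ≥ -D`.

Conversely, `t / w` extends holomorphically wherever `ord t ≥ ord w`
(`exists_holomorphicSections_tmul_eq`). For `D ≤ 0` this is `ord t ≥ 0 ≥ D`; for `D ≥ 0` it is the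
condition that cuts out the target space. For general `D`, a section `t` in the target is given only
off the support of `D₋`. At a point of that support `t ⊗ s₋` is square integrable for the unweighted
form, so it extends and `t` has positive order there, whereas `D₊` vanishes; thus `t / s₊` extends
to all of `M`.

The measure of a 2-form is a supremum of chart measures. It enters only through three facts: it
dominates each chart measure, it does not charge closed discrete sets, and it commutes with
multiplication by a weight. Agreement of chart measures on overlaps is never needed. -/

theorem ofReal_two_pi_mul_enorm_le_lintegral_circleMap {f : ℂ → F} {z : ℂ} {r : ℝ} (hr : 0 < r)
    (hf : ∀ w ∈ Metric.closedBall z r, DifferentiableAt ℂ f w) :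
    ENNReal.ofReal (2 * Real.pi) * ‖f z‖ₑ ≤
      ∫⁻ θ in Set.Ioo (-Real.pi) Real.pi, ‖f (circleMap z r θ)‖ₑ := by
  have h1 : Real.circleAverage f z r = f z := by
    apply circleAverage_of_differentiable_on_off_countable Set.countable_empty
    · intro w hw
      rw [abs_of_pos hr] at hw
      exact (hf w hw).continuousAt.continuousWithinAt
    · intro w hw
      rw [abs_of_pos hr] at hw
      exact hf w (Metric.ball_subset_closedBall hw.1)
  -- Polar coordinates take angles in `(-π, π)`, circle averages in `(0, 2π)`; periodicity
  -- reconciles them.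
  have h2 : ∫ θ in (-Real.pi)..Real.pi, f (circleMap z r θ) =
      ∫ θ in 0..2 * Real.pi, f (circleMap z r θ) := by
    have hp : Function.Periodic (fun θ ↦ f (circleMap z r θ)) (2 * Real.pi) := fun θ ↦ by
      simp only [periodic_circleMap z r θ]
    have := hp.intervalIntegral_add_eq (-Real.pi) 0
    rw [zero_add, show -Real.pi + 2 * Real.pi = Real.pi by ring] at this
    exact this
  have h3 : (2 * Real.pi) • f z = ∫ θ in Set.Ioo (-Real.pi) Real.pi, f (circleMap z r θ) := by
    rw [← integral_Ioc_eq_integral_Ioo,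
      ← intervalIntegral.integral_of_le (by linarith [Real.pi_pos]), h2, ← h1,
      Real.circleAverage_def, smul_smul, mul_inv_cancel₀ (by positivity), one_smul]
  calc ENNReal.ofReal (2 * Real.pi) * ‖f z‖ₑ = ‖(2 * Real.pi) • f z‖ₑ := by
        rw [enorm_smul, Real.enorm_of_nonneg (by positivity)]
    _ ≤ _ := by rw [h3]; exact enorm_integral_le_lintegral_enorm _

/-- The area version of the mean value inequality for holomorphic functions. -/
theorem ofReal_pi_mul_sq_mul_enorm_le_lintegral_ball {f : ℂ → F} {z : ℂ} {r : ℝ} (hr : 0 < r)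
    (hf : ∀ w ∈ Metric.ball z r, DifferentiableAt ℂ f w) :
    ENNReal.ofReal (Real.pi * r ^ 2) * ‖f z‖ₑ ≤ ∫⁻ w in Metric.ball z r, ‖f w‖ₑ := by
  -- Extending by zero allows the polar change of variables over the whole plane. The circle
  -- inequality is integrated against `ρ dρ` on `(0, r)`, and `2π · r² / 2` is the area of the disc.
  set G : ℂ → ℝ≥0∞ := (Metric.ball z r).indicator fun w ↦ ‖f w‖ₑ with hG
  have hGm : Measurable G := by
    have hc : ContinuousOn (fun w ↦ ‖f w‖ₑ) (Metric.ball z r) := fun w hw ↦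
      (hf w hw).continuousAt.enorm.continuousWithinAt
    classical
    rw [hG, ← Set.piecewise_eq_indicator]
    exact hc.measurable_piecewise continuousOn_const Metric.isOpen_ball.measurableSet
  have hpm : Measurable fun p : ℝ × ℝ ↦
      ENNReal.ofReal p.1 • G (z + Complex.polarCoord.symm p) := by
    simp only [Complex.polarCoord_symm_apply, smul_eq_mul]
    refine (ENNReal.measurable_ofReal.comp measurable_fst).mul (hGm.comp ?_)
    fun_prop
  have hcirc : ∀ ρ ∈ Set.Ioo 0 r, ENNReal.ofReal (2 * Real.pi) * ‖f z‖ₑ ≤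
      ∫⁻ θ in Set.Ioo (-Real.pi) Real.pi, G (z + Complex.polarCoord.symm (ρ, θ)) := by
    intro ρ hρ
    refine (ofReal_two_pi_mul_enorm_le_lintegral_circleMap (f := f) hρ.1 fun w hw ↦
      hf w (Metric.closedBall_subset_ball hρ.2 hw)).trans (le_of_eq ?_)
    refine lintegral_congr fun θ ↦ ?_
    have hcm : z + Complex.polarCoord.symm (ρ, θ) = circleMap z ρ θ := by
      simp [circleMap, Complex.exp_mul_I]
    rw [hcm, hG, Set.indicator_of_mem]
    exact Metric.closedBall_subset_ball hρ.2
      (Metric.sphere_subset_closedBall (circleMap_mem_sphere z hρ.1.le θ))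
  have hint : ∫⁻ ρ in Set.Ioo 0 r, ENNReal.ofReal ρ = ENNReal.ofReal (r ^ 2 / 2) := by
    rw [← ofReal_integral_eq_lintegral_ofReal]
    · rw [← integral_Ioc_eq_integral_Ioo, ← intervalIntegral.integral_of_le hr.le, integral_id]
      simp
    · exact ((continuous_id.integrableOn_Icc (a := 0) (b := r)).mono_set Set.Ioo_subset_Icc_self)
    · exact (ae_restrict_mem measurableSet_Ioo).mono fun x hx ↦ hx.1.le
  calc ENNReal.ofReal (Real.pi * r ^ 2) * ‖f z‖ₑ
      = ∫⁻ ρ in Set.Ioo 0 r, ENNReal.ofReal ρ * (ENNReal.ofReal (2 * Real.pi) * ‖f z‖ₑ) := by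
        rw [lintegral_mul_const _ ENNReal.measurable_ofReal, hint, ← mul_assoc,
          ← ENNReal.ofReal_mul (by positivity)]
        congr 2
        ring
    _ ≤ ∫⁻ ρ in Set.Ioo 0 r, ENNReal.ofReal ρ *
          ∫⁻ θ in Set.Ioo (-Real.pi) Real.pi, G (z + Complex.polarCoord.symm (ρ, θ)) := by
        refine setLIntegral_mono' measurableSet_Ioo fun ρ hρ ↦ ?_
        gcongr
        exact hcirc ρ hρ
    _ ≤ ∫⁻ ρ in Set.Ioi (0 : ℝ), ∫⁻ θ in Set.Ioo (-Real.pi) Real.pi,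
          ENNReal.ofReal ρ • G (z + Complex.polarCoord.symm (ρ, θ)) := by
        refine (lintegral_mono_set (Set.Ioo_subset_Ioi_self)).trans (le_of_eq ?_)
        refine lintegral_congr fun ρ ↦ ?_
        simp only [smul_eq_mul]
        rw [lintegral_const_mul' _ _ ENNReal.ofReal_ne_top]
    _ = ∫⁻ p in polarCoord.target, ENNReal.ofReal p.1 • G (z + Complex.polarCoord.symm p) := by
        rw [polarCoord_target, Measure.volume_eq_prod, ← Measure.prod_restrict,
          lintegral_prod _ hpm.aemeasurable]
    _ = ∫⁻ w, G w := by
        rw [Complex.lintegral_comp_polarCoord_symm fun w ↦ G (z + w),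
          lintegral_add_left_eq_self]
    _ = ∫⁻ w in Metric.ball z r, ‖f w‖ₑ :=
        lintegral_indicator Metric.isOpen_ball.measurableSet _

/-- The passage from the `L¹` mean value inequality to an `L²` bound uses a pointwise
arithmetic–geometric inequality in place of Cauchy–Schwarz. With weights `r / ε` and `ε / (4r)`,
both resulting terms are multiples of `r ε`, and the final constant works because `1 + π / 4 ≤ π`.
-/
theorem ofReal_mul_enorm_le_of_sq {f : ℂ → F} {z : ℂ} {r ε : ℝ} (hr : 0 < r) (hε : 0 < ε)
    (hf : ∀ w ∈ Metric.ball z r, DifferentiableAt ℂ f w)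
    (hi : ∫⁻ w in Metric.ball z r, ‖f w‖ₑ ^ 2 ≤ ENNReal.ofReal (ε ^ 2)) :
    r * ‖f z‖ ≤ ε := by
  have hV : volume (Metric.ball z r) = ENNReal.ofReal (Real.pi * r ^ 2) := by
    rw [Complex.volume_ball, mul_comm, ENNReal.ofReal_mul Real.pi_pos.le,
      ENNReal.ofReal_pow hr.le, ← NNReal.coe_real_pi, ENNReal.ofReal_coe_nnreal]
  have key : ∀ w, ‖f w‖ₑ ≤ ENNReal.ofReal (r / ε) * ‖f w‖ₑ ^ 2 + ENNReal.ofReal (ε / (4 * r)) := by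
    intro w
    rw [← ofReal_norm, ← ENNReal.ofReal_pow (norm_nonneg _),
      ← ENNReal.ofReal_mul (by positivity), ← ENNReal.ofReal_add (by positivity) (by positivity)]
    refine ENNReal.ofReal_le_ofReal ?_
    have : r / ε * ‖f w‖ ^ 2 + ε / (4 * r) - ‖f w‖ =
        r / ε * (‖f w‖ - ε / (2 * r)) ^ 2 := by
      field_simp
      ring
    nlinarith [show 0 ≤ r / ε * (‖f w‖ - ε / (2 * r)) ^ 2 by positivity]
  have h1 : ENNReal.ofReal (Real.pi * r ^ 2) * ‖f z‖ₑ ≤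
      ENNReal.ofReal (r / ε) * ENNReal.ofReal (ε ^ 2) +
        ENNReal.ofReal (ε / (4 * r)) * ENNReal.ofReal (Real.pi * r ^ 2) := by
    refine (ofReal_pi_mul_sq_mul_enorm_le_lintegral_ball hr hf).trans ?_
    refine (lintegral_mono key).trans ?_
    rw [lintegral_add_right _ measurable_const, lintegral_const_mul' _ _ ENNReal.ofReal_ne_top,
      setLIntegral_const, hV]
    gcongr
  rw [← ofReal_norm, ← ENNReal.ofReal_mul (by positivity),
    ← ENNReal.ofReal_mul (by positivity), ← ENNReal.ofReal_mul (by positivity),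
    ← ENNReal.ofReal_add (by positivity) (by positivity),
    ENNReal.ofReal_le_ofReal_iff (by positivity)] at h1
  have h2 : r / ε * ε ^ 2 + ε / (4 * r) * (Real.pi * r ^ 2) = r * (ε + ε * Real.pi / 4) := by
    field_simp
  rw [h2, show Real.pi * r ^ 2 * ‖f z‖ = r * (Real.pi * (r * ‖f z‖)) by ring] at h1
  have h3 := le_of_mul_le_mul_left h1 hr
  have hpi := Real.pi_gt_three
  have h4 : ε + ε * Real.pi / 4 ≤ Real.pi * ε := by nlinarith
  exact le_of_mul_le_mul_left (h3.trans h4) Real.pi_pos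

/-- A holomorphic function on a punctured disc that is square integrable extends holomorphically
across the puncture. -/
theorem exists_analyticAt_of_lintegral_enorm_sq_lt_top {f : ℂ → F} {c : ℂ} {N : Set ℂ}
    (hN : N ∈ 𝓝[≠] c) (hd : ∀ᶠ z in 𝓝[≠] c, DifferentiableAt ℂ f z)
    (hi : ∫⁻ w in N, ‖f w‖ₑ ^ 2 < ⊤) :
    ∃ g : ℂ → F, AnalyticAt ℂ g c ∧ f =ᶠ[𝓝[≠] c] g := by
  obtain ⟨R, hR, hRs⟩ := (nhdsWithin_hasBasis Metric.nhds_basis_ball _).mem_iff.1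
    (inter_mem hN hd)
  have hi' : ∫⁻ w in Metric.ball c R, ‖f w‖ₑ ^ 2 ≠ ⊤ := by
    have he : (Metric.ball c R ∩ {c}ᶜ : Set ℂ) =ᵐ[volume] Metric.ball c R := by
      refine inter_ae_eq_left_of_ae_eq_univ ?_
      rw [ae_eq_univ, compl_compl]
      exact measure_singleton c
    rw [← setLIntegral_congr he]
    exact ((lintegral_mono_set fun w hw ↦ (hRs hw).1).trans_lt hi).ne
  -- Absolute continuity of the integral: the mass near the puncture tends to zero. Mere finiteness
  -- would only give `O`, whereas the removable singularity theorem needs `o`.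
  have ht : Tendsto (fun r : ℝ ↦ ∫⁻ w in Metric.ball c r, ‖f w‖ₑ ^ 2
      ∂(volume.restrict (Metric.ball c R))) (𝓝[>] 0) (𝓝 0) := by
    refine tendsto_setLIntegral_zero hi' ?_
    have hv : Tendsto (fun r : ℝ ↦ ENNReal.ofReal r ^ 2 * NNReal.pi) (𝓝[>] 0) (𝓝 0) := by
      have : ContinuousAt (fun r : ℝ ↦ ENNReal.ofReal r ^ 2 * (NNReal.pi : ℝ≥0∞)) 0 := by
        refine Continuous.continuousAt ?_
        exact (ENNReal.continuous_mul_const ENNReal.coe_ne_top).comp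
          ((ENNReal.continuous_pow 2).comp ENNReal.continuous_ofReal)
      have h0 := this.tendsto
      simp only [ENNReal.ofReal_zero, ne_eq, OfNat.ofNat_ne_zero, not_false_eq_true, zero_pow,
        zero_mul] at h0
      exact h0.mono_left nhdsWithin_le_nhds
    refine tendsto_of_tendsto_of_tendsto_of_le_of_le tendsto_const_nhds hv (fun _ ↦ zero_le)
      fun r ↦ ?_
    refine (Measure.restrict_apply_le _ _).trans (le_of_eq ?_)
    exact Complex.volume_ball c r
  set f₀ : ℂ → F := Function.update f c 0 with hf₀
  have hff : f =ᶠ[𝓝[≠] c] f₀ := by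
    filter_upwards [self_mem_nhdsWithin] with z hz
    rw [hf₀, Function.update_of_ne hz]
  have hd₀ : DifferentiableOn ℂ f₀ (Metric.ball c R \ {c}) := by
    refine DifferentiableOn.congr (f := f) ?_ ?_
    · exact fun z hz ↦ (hRs ⟨hz.1, hz.2⟩).2.differentiableWithinAt
    · exact fun z hz ↦ Function.update_of_ne hz.2 _ _
  have ho : (fun z ↦ f₀ z - f₀ c) =o[𝓝[≠] c] fun z ↦ (z - c)⁻¹ := by
    rw [Asymptotics.isLittleO_iff]
    intro ε hε
    have h1 := ht.eventually (Iic_mem_nhds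
      (show 0 < ENNReal.ofReal ((ε / 2) ^ 2) by rw [ENNReal.ofReal_pos]; positivity))
    obtain ⟨δ, hδ, hδs⟩ := (mem_nhdsGT_iff_exists_Ioo_subset (a := (0 : ℝ))).1 h1
    have hδ : (0 : ℝ) < δ := hδ
    filter_upwards [self_mem_nhdsWithin, mem_nhdsWithin_of_mem_nhds
      (Metric.ball_mem_nhds c (show 0 < min (δ / 2) (R / 2) by positivity))] with z hz hz'
    have hz0 : 0 < ‖z - c‖ := norm_pos_iff.2 (sub_ne_zero.2 hz)
    have hzd : ‖z - c‖ < min (δ / 2) (R / 2) := by rwa [mem_ball_iff_norm] at hz'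
    have hz1 : ‖z - c‖ < δ / 2 := hzd.trans_le (min_le_left _ _)
    have hz2 : ‖z - c‖ < R / 2 := hzd.trans_le (min_le_right _ _)
    have hmem := hδs (show 2 * ‖z - c‖ ∈ Set.Ioo 0 δ from ⟨by positivity, by linarith⟩)
    -- The disc of radius `‖z - c‖ / 2` about `z` misses `c`, and it lies in a disc about `c` on
    -- which the integral is already small.
    have hsub : Metric.ball z (‖z - c‖ / 2) ⊆ Metric.ball c (2 * ‖z - c‖) := by
      intro w hw
      rw [mem_ball_iff_norm] at hw ⊢
      calc ‖w - c‖ = ‖(w - z) + (z - c)‖ := by ring_nf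
        _ ≤ _ := norm_add_le _ _
        _ < _ := by linarith
    have hsub' : Metric.ball z (‖z - c‖ / 2) ⊆ Metric.ball c R :=
      hsub.trans (Metric.ball_subset_ball (by linarith))
    have := ofReal_mul_enorm_le_of_sq (f := f) (z := z) (r := ‖z - c‖ / 2) (ε := ε / 2)
      (by positivity) (by positivity) (fun w hw ↦ (hRs ⟨hsub' hw, fun hwc ↦ by
        rw [Set.mem_singleton_iff.1 hwc, mem_ball_iff_norm, norm_sub_rev] at hw
        linarith⟩).2) (by
        refine le_trans ?_ hmem
        rw [Measure.restrict_restrict Metric.isOpen_ball.measurableSet]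
        exact lintegral_mono_set (Set.subset_inter hsub hsub'))
    rw [hf₀, Function.update_of_ne hz, Function.update_self, sub_zero, norm_inv,
      ← div_eq_mul_inv, le_div_iff₀ hz0]
    linarith
  refine ⟨Function.update f₀ c (limUnder (𝓝[≠] c) f₀), ?_, hff.trans ?_⟩
  · exact (Complex.differentiableOn_update_limUnder_of_isLittleO (Metric.ball_mem_nhds c hR)
      hd₀ ho).analyticAt (Metric.ball_mem_nhds c hR)
  · filter_upwards [self_mem_nhdsWithin] with z hz
    rw [Function.update_of_ne hz]

end RemovableSingularity

/-! ### Suprema of measures and measures of weighted volume forms -/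

section Measures

/-- A supremum of measures is not computed set by set. Instead, restricting the supremum to the
complement of `S` still bounds every `μ i`, so by minimality the supremum is dominated by this
restriction. -/
theorem MeasureTheory.Measure.iSup_apply_eq_zero {α ι : Type*} [MeasurableSpace α]
    {μ : ι → Measure α} {S : Set α} (hS : MeasurableSet S) (h : ∀ i, μ i S = 0) :
    (⨆ i, μ i) S = 0 := by
  have hle : (⨆ i, μ i) ≤ (⨆ i, μ i).restrict Sᶜ := by
    refine iSup_le fun i ↦ ?_
    have hi : μ i = (μ i).restrict Sᶜ :=
      (Measure.restrict_eq_self_of_ae_mem (measure_eq_zero_iff_ae_notMem.1 (h i))).symm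
    rw [hi]
    exact Measure.restrict_mono le_rfl (le_iSup μ i)
  refine le_antisymm ((hle S).trans (le_of_eq ?_)) zero_le
  rw [Measure.restrict_apply hS, Set.inter_compl_self, measure_empty]

/-- Multiplication by `g` is monotone in the measure and is undone on each `μ i` by `g⁻¹`. So each
`μ i` lies below `ν` weighted by `g⁻¹`, hence so does the supremum; multiplying back by `g` costs
nothing because `g⁻¹ * g ≤ 1` everywhere. -/
theorem MeasureTheory.Measure.withDensity_iSup {α ι : Type*} [MeasurableSpace α]
    (μ : ι → Measure α) {g : α → ℝ≥0∞} (hg : Measurable g) (htop : ∀ x, g x ≠ ⊤)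
    (h0 : ∀ i, ∀ᵐ x ∂μ i, g x ≠ 0) :
    (⨆ i, μ i).withDensity g = ⨆ i, (μ i).withDensity g := by
  have hmono : ∀ {ν ν' : Measure α} (k : α → ℝ≥0∞), ν ≤ ν' →
      ν.withDensity k ≤ ν'.withDensity k := fun k h ↦ by
    refine Measure.le_iff.2 fun s hs ↦ ?_
    rw [withDensity_apply _ hs, withDensity_apply _ hs]
    exact lintegral_mono' (Measure.restrict_mono le_rfl h) le_rfl
  refine le_antisymm ?_ (iSup_le fun i ↦ hmono g (le_iSup μ i))
  set ν := ⨆ i, (μ i).withDensity g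
  have h1 : (⨆ i, μ i) ≤ ν.withDensity g⁻¹ := by
    refine iSup_le fun i ↦ ?_
    rw [← withDensity_inv_same hg (h0 i) (Eventually.of_forall htop)]
    exact hmono _ (le_iSup (fun i ↦ (μ i).withDensity g) i)
  calc (⨆ i, μ i).withDensity g ≤ (ν.withDensity g⁻¹).withDensity g := hmono g h1
    _ = ν.withDensity (g⁻¹ * g) := (withDensity_mul _ hg.inv hg).symm
    _ ≤ ν.withDensity 1 := withDensity_mono (Eventually.of_forall fun x ↦ by
        simp only [Pi.mul_apply, Pi.inv_apply, Pi.one_apply]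
        rw [mul_comm]
        exact ENNReal.mul_inv_le_one _)
    _ = ν := withDensity_one

variable {M : Type*} [TopologicalSpace M] [ChartedSpace ℂ M] [MeasurableSpace M] [BorelSpace M]

theorem aemeasurable_chart_symm (φ : OpenPartialHomeomorph M ℂ) (k : ℂ → ℝ≥0∞) :
    AEMeasurable φ.symm ((volume.restrict φ.target).withDensity k) :=
  (φ.continuousOn_symm.aemeasurable φ.open_target.measurableSet).mono_ac
    (withDensity_absolutelyContinuous _ _)

/-- The preimage of `S` in the chart has only isolated points, and a set that is locally a single
point is Lebesgue null. -/
theorem TwoForm.chartMeasure_apply_eq_zero (θ : TwoForm M) (φ : OpenPartialHomeomorph M ℂ)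
    {S : Set M} (hS : IsClosed S) (hd : ∀ p, ∀ᶠ x in 𝓝[≠] p, x ∉ S) :
    θ.chartMeasure φ S = 0 := by
  rw [TwoForm.chartMeasure, Measure.map_apply_of_aemeasurable (aemeasurable_chart_symm φ _)
    hS.measurableSet]
  refine withDensity_absolutelyContinuous _ _ ?_
  rw [Measure.restrict_apply' φ.open_target.measurableSet]
  refine measure_null_of_locally_null _ fun z hz ↦ ⟨{z}, ?_, measure_singleton z⟩
  have ht : Tendsto φ.symm (𝓝[≠] z) (𝓝[≠] (φ.symm z)) := by
    refine tendsto_nhdsWithin_iff.2 ⟨(φ.continuousAt_symm hz.2).mono_left nhdsWithin_le_nhds, ?_⟩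
    filter_upwards [self_mem_nhdsWithin,
      mem_nhdsWithin_of_mem_nhds (φ.open_target.mem_nhds hz.2)] with w hw hwt heq
    exact hw (φ.symm.injOn hwt hz.2 heq)
  have h1 := ht.eventually (hd (φ.symm z))
  rw [eventually_nhdsWithin_iff] at h1
  rw [mem_nhdsWithin_iff_eventually]
  filter_upwards [h1] with w hw hwm
  by_contra hne
  exact hw hne hwm.1

theorem TwoForm.measure_apply_eq_zero (θ : TwoForm M) {S : Set M} (hS : IsClosed S)
    (hd : ∀ p, ∀ᶠ x in 𝓝[≠] p, x ∉ S) : θ.measure S = 0 :=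
  Measure.iSup_apply_eq_zero hS.measurableSet fun φ ↦ θ.chartMeasure_apply_eq_zero φ.1 hS hd

/-- In every chart, scaling the form scales its density, and weighting commutes with the supremum
over charts. Nothing is known about `g` on `S`, where a weight may come from the meaningless value
of a section at a pole; the density is set to zero there, which is harmless since `S` is null. -/
theorem TwoForm.measure_smul {θ : TwoForm M} (hθ : θ.IsPositiveContinuous) {S : Set M}
    (hS : IsClosed S) (hd : ∀ p, ∀ᶠ x in 𝓝[≠] p, x ∉ S) {g : M → ℝ}
    (hgc : ContinuousOn g Sᶜ) (hg0 : ∀ x ∉ S, 0 < g x) :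
    TwoForm.measure (fun x ↦ g x • θ x) =
      θ.measure.withDensity (Sᶜ.indicator fun x ↦ ENNReal.ofReal (g x)) := by
  set G : M → ℝ≥0∞ := Sᶜ.indicator fun x ↦ ENNReal.ofReal (g x) with hG
  have hGm : Measurable G := by
    classical
    rw [hG, ← Set.piecewise_eq_indicator]
    refine ContinuousOn.measurable_piecewise ?_ continuousOn_const hS.isOpen_compl.measurableSet
    exact ENNReal.continuous_ofReal.comp_continuousOn hgc
  have hGae : ∀ φ : atlas ℂ M, ∀ᵐ x ∂θ.chartMeasure φ.1, G x = ENNReal.ofReal (g x) ∧ x ∉ S := by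
    intro φ
    filter_upwards [measure_eq_zero_iff_ae_notMem.1
      (θ.chartMeasure_apply_eq_zero φ.1 hS hd)] with x hx
    exact ⟨Set.indicator_of_mem hx _, hx⟩
  rw [TwoForm.measure, TwoForm.measure, Measure.withDensity_iSup _ hGm]
  · congr 1
    funext φ
    have hdm : AEMeasurable (fun z ↦ ENNReal.ofReal (θ.density φ.1 z))
        (volume.restrict φ.1.target) :=
      ((hθ φ.1 φ.2).1.aemeasurable φ.1.open_target.measurableSet).ennreal_ofReal
    have hsm : AEMeasurable φ.1.symm (volume.restrict φ.1.target) :=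
      φ.1.continuousOn_symm.aemeasurable φ.1.open_target.measurableSet
    -- Since the density of `θ` is strictly positive, nullity for the chart measure gives nullity
    -- for Lebesgue measure.
    have hnull : ∀ᵐ z ∂volume.restrict φ.1.target, φ.1.symm z ∉ S := by
      have h0 := θ.chartMeasure_apply_eq_zero φ.1 hS hd
      rw [TwoForm.chartMeasure, Measure.map_apply_of_aemeasurable
        (aemeasurable_chart_symm φ.1 _) hS.measurableSet,
        withDensity_apply_eq_zero' hdm] at h0
      have h1 := measure_eq_zero_iff_ae_notMem.1 h0
      filter_upwards [h1, ae_restrict_mem φ.1.open_target.measurableSet] with z hz hzt hzS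
      refine hz ⟨?_, hzS⟩
      simp only [ne_eq, ENNReal.ofReal_eq_zero, not_le, Set.mem_ofPred_eq]
      exact (hθ φ.1 φ.2).2 z hzt
    have hwd : (volume.restrict φ.1.target).withDensity (fun z ↦ ENNReal.ofReal
        (TwoForm.density (fun x ↦ g x • θ x) φ.1 z)) =
        ((volume.restrict φ.1.target).withDensity fun z ↦
          ENNReal.ofReal (θ.density φ.1 z)).withDensity (G ∘ φ.1.symm) := by
      rw [← withDensity_mul₀ hdm (hGm.comp_aemeasurable hsm)]
      refine withDensity_congr_ae ?_
      filter_upwards [hnull] with z hz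
      have hGz : G (φ.1.symm z) = ENNReal.ofReal (g (φ.1.symm z)) := Set.indicator_of_mem hz _
      simp only [Pi.mul_apply, Function.comp_apply, hGz]
      rw [mul_comm, ← ENNReal.ofReal_mul (hg0 _ hz).le]
      rfl
    rw [TwoForm.chartMeasure, hwd, TwoForm.chartMeasure]
    ext A hA
    have hsm' := aemeasurable_chart_symm φ.1 fun z ↦ ENNReal.ofReal (θ.density φ.1 z)
    rw [withDensity_apply _ hA, Measure.map_apply_of_aemeasurable
      (hsm'.mono_ac (withDensity_absolutelyContinuous _ _)) hA]
    rw [Measure.restrict_map_of_aemeasurable hsm' hA,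
      lintegral_map' hGm.aemeasurable (hsm'.mono_measure Measure.restrict_le_self)]
    rw [withDensity_apply₀ _ (hsm'.nullMeasurable hA)]
    rfl
  · exact fun x ↦ by
      rw [hG]
      by_cases hx : x ∈ Sᶜ <;> simp [hx]
  · intro φ
    filter_upwards [hGae φ] with x hx
    rw [hx.1]
    simpa using hg0 x hx.2

end Measures

/-! ### Local representatives of sections -/

section LocalRep

variable {M : Type*} [TopologicalSpace M] [ChartedSpace ℂ M]
  {F : Type*} [NormedAddCommGroup F] [NormedSpace ℂ F]
  {E : M → Type*} [∀ x, AddCommGroup (E x)] [∀ x, Module ℂ (E x)]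
  [TopologicalSpace (TotalSpace F E)] [∀ x, TopologicalSpace (E x)]
  [FiberBundle F E] [VectorBundle ℂ F E]

theorem tendsto_chartAt_symm (p : M) :
    Tendsto (chartAt ℂ p).symm (𝓝 (chartAt ℂ p p)) (𝓝 p) := by
  have := (chartAt ℂ p).continuousAt_symm (mem_chart_target ℂ p)
  rwa [ContinuousAt, (chartAt ℂ p).left_inv (mem_chart_source ℂ p)] at this

theorem tendsto_chartAt_symm_punctured (p : M) :
    Tendsto (chartAt ℂ p).symm (𝓝[≠] (chartAt ℂ p p)) (𝓝[≠] p) := by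
  refine tendsto_nhdsWithin_iff.2 ⟨(tendsto_chartAt_symm p).mono_left nhdsWithin_le_nhds, ?_⟩
  filter_upwards [self_mem_nhdsWithin, mem_nhdsWithin_of_mem_nhds (chart_target_mem_nhds ℂ p)]
    with z hz hzt heq
  exact hz (((chartAt ℂ p).right_inv hzt).symm.trans
    (congrArg (chartAt ℂ p) (Set.mem_singleton_iff.1 heq)))

theorem localRep_congr_punctured {s t : ∀ x, E x} {p : M} (h : ∀ᶠ x in 𝓝[≠] p, s x = t x) :
    localRep F s p =ᶠ[𝓝[≠] (chartAt ℂ p p)] localRep F t p := by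
  filter_upwards [(tendsto_chartAt_symm_punctured p).eventually h] with z hz
  simp only [localRep, hz]

theorem localRep_congr {s t : ∀ x, E x} {p : M} (h : ∀ᶠ x in 𝓝 p, s x = t x) :
    localRep F s p =ᶠ[𝓝 (chartAt ℂ p p)] localRep F t p := by
  filter_upwards [(tendsto_chartAt_symm p).eventually h] with z hz
  simp only [localRep, hz]

theorem localRep_self (s : ∀ x, E x) (p : M) :
    localRep F s p (chartAt ℂ p p) = (trivializationAt F E p ⟨p, s p⟩).2 := by
  simp only [localRep]
  rw [(chartAt ℂ p).left_inv (mem_chart_source ℂ p)]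

theorem symm_localRep_self (s : ∀ x, E x) (p : M) :
    (trivializationAt F E p).symm p (localRep F s p (chartAt ℂ p p)) = s p := by
  rw [localRep_self]
  exact (trivializationAt F E p).symm_apply_apply_mk (mem_baseSet_trivializationAt F E p) (s p)

/-- Holomorphy at `p` is tested in the preferred chart and frame at `p` itself, so no coordinate
change enters. This turns questions about sections into one-variable ones. -/
theorem contMDiffAt_section_iff_analyticAt_localRep [CompleteSpace F] {s : ∀ x, E x} {p : M} :
    ContMDiffAt 𝓘(ℂ) (𝓘(ℂ).prod 𝓘(ℂ, F)) ω (fun x ↦ TotalSpace.mk' F x (s x)) p ↔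
      AnalyticAt ℂ (localRep F s p) (chartAt ℂ p p) := by
  rw [contMDiffAt_section]
  constructor
  · intro hs
    have h := (contMDiffAt_iff.1 hs).2
    simp only [mfld_simps] at h
    rw [contDiffWithinAt_univ] at h
    exact ContDiffAt.analyticAt h
  · intro h
    refine contMDiffAt_iff.2 ⟨?_, ?_⟩
    · have hc : ContinuousAt (localRep F s p ∘ chartAt ℂ p) p :=
        ContinuousAt.comp h.continuousAt ((chartAt ℂ p).continuousAt (mem_chart_source ℂ p))
      refine hc.congr ?_
      filter_upwards [chart_source_mem_nhds ℂ p] with x hx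
      simp only [Function.comp_apply, localRep]
      rw [(chartAt ℂ p).left_inv hx]
    · simp only [mfld_simps]
      rw [contDiffWithinAt_univ]
      exact h.contDiffAt

/-- Here the chart and frame stay those at `p` while the point moves, so the holomorphic
compatibility of charts and frames is needed. It supplies differentiability on a whole punctured
disc. -/
theorem differentiableAt_localRep [IsManifold 𝓘(ℂ) ω M] [ContMDiffVectorBundle ω F E 𝓘(ℂ)]
    {s : ∀ x, E x} {p : M} {z : ℂ} (hz : z ∈ (chartAt ℂ p).target)
    (hb : (chartAt ℂ p).symm z ∈ (trivializationAt F E p).baseSet)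
    (hs : ContMDiffAt 𝓘(ℂ) (𝓘(ℂ).prod 𝓘(ℂ, F)) ω (fun x ↦ TotalSpace.mk' F x (s x))
      ((chartAt ℂ p).symm z)) :
    DifferentiableAt ℂ (localRep F s p) z := by
  have h1 := ((trivializationAt F E p).contMDiffAt_section_iff (IB := 𝓘(ℂ)) hb).1 hs
  have h2 : ContMDiffAt 𝓘(ℂ) 𝓘(ℂ) ω (chartAt ℂ p).symm z :=
    (contMDiffOn_chart_symm (I := 𝓘(ℂ)) (n := ω) (x := p)).contMDiffAt
      ((chartAt ℂ p).open_target.mem_nhds hz)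
  have h3 := ContMDiffAt.comp z h1 h2
  rw [contMDiffAt_iff_contDiffAt] at h3
  exact h3.differentiableAt (by simp)

/-- A section that is holomorphic off a closed discrete set, and whose local representatives at
the points of this set agree off the point with analytic functions, extends to a holomorphic
section. -/
theorem exists_holomorphicSections_of_analyticAt [CompleteSpace F] {S : Set M} (hS : IsClosed S)
    (hd : ∀ p, ∀ᶠ x in 𝓝[≠] p, x ∉ S) {s₀ : ∀ x, E x}
    (h₀ : ∀ p ∉ S, AnalyticAt ℂ (localRep F s₀ p) (chartAt ℂ p p))
    (h₁ : ∀ p ∈ S, ∃ g : ℂ → F, AnalyticAt ℂ g (chartAt ℂ p p) ∧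
      localRep F s₀ p =ᶠ[𝓝[≠] (chartAt ℂ p p)] g) :
    ∃ s ∈ holomorphicSections F E ⊤, ∀ x ∉ S, s x = s₀ x := by
  classical
  choose! g hg hge using h₁
  -- At a point of `S` the new value is that of the analytic continuation, carried back to the fibre
  -- by the frame at that same point.
  let s : ∀ x, E x := fun x ↦
    if x ∈ S then (trivializationAt F E x).symm x (g x (chartAt ℂ x x)) else s₀ x
  have hs : ∀ x ∉ S, s x = s₀ x := fun x hx ↦ if_neg hx
  refine ⟨s, ⟨fun x hx ↦ absurd trivial hx, fun p _ ↦ ContMDiffAt.contMDiffWithinAt ?_⟩, hs⟩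
  rw [contMDiffAt_section_iff_analyticAt_localRep]
  by_cases hp : p ∈ S
  · refine (hg p hp).congr ?_
    have h1 : g p =ᶠ[𝓝[≠] (chartAt ℂ p p)] localRep F s p :=
      (hge p hp).symm.trans (localRep_congr_punctured ((hd p).mono fun x hx ↦ (hs x hx).symm))
    refine eventuallyEq_nhds_of_eventuallyEq_nhdsNE h1 ?_
    rw [localRep_self, show s p = _ from if_pos hp]
    rw [(trivializationAt F E p).apply_mk_symm (mem_baseSet_trivializationAt F E p)]
  · refine (h₀ p hp).congr (localRep_congr ?_)
    filter_upwards [hS.isOpen_compl.mem_nhds hp] with x hx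
    exact (hs x hx).symm

/-- By continuity the local representative at `p` is the limit of its values nearby. This is what
makes holomorphic sections determined by their values off a discrete set. -/
theorem eq_zero_of_eventually_punctured [CompleteSpace F] {s : ∀ x, E x} {p : M}
    (hs : ContMDiffAt 𝓘(ℂ) (𝓘(ℂ).prod 𝓘(ℂ, F)) ω (fun x ↦ TotalSpace.mk' F x (s x)) p)
    (h : ∀ᶠ x in 𝓝[≠] p, s x = 0) : s p = 0 := by
  have hc := (contMDiffAt_section_iff_analyticAt_localRep.1 hs).continuousAt
  have h0 : localRep F (0 : ∀ x, E x) p =ᶠ[𝓝 (chartAt ℂ p p)] 0 := by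
    have h := localRep_add_smul (F := F) (0 : ∀ x, E x) 0 (-1) p
    rw [smul_zero, add_zero] at h
    filter_upwards [h] with z hz
    rw [hz]
    simp
  have h1 : localRep F s p =ᶠ[𝓝[≠] (chartAt ℂ p p)] fun _ ↦ 0 :=
    (localRep_congr_punctured h).trans (h0.filter_mono nhdsWithin_le_nhds)
  have h2 := tendsto_nhds_unique ((hc.tendsto.mono_left nhdsWithin_le_nhds).congr' h1)
    tendsto_const_nhds
  have h3 := symm_localRep_self (F := F) s p
  rw [h2, ← (trivializationAt F E p).symmₗ_apply (R := ℂ) (mem_baseSet_trivializationAt F E p),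
    map_zero] at h3
  exact h3.symm

theorem ordAt_nonneg_of_contMDiffAt [CompleteSpace F] {s : ∀ x, E x} {p : M}
    (hs : ContMDiffAt 𝓘(ℂ) (𝓘(ℂ).prod 𝓘(ℂ, F)) ω (fun x ↦ TotalSpace.mk' F x (s x)) p) :
    0 ≤ ordAt F s p :=
  (contMDiffAt_section_iff_analyticAt_localRep.1 hs).meromorphicOrderAt_nonneg

theorem ne_zero_of_ordAt_eq_zero [CompleteSpace F] {s : ∀ x, E x} {p : M}
    (hs : ContMDiffAt 𝓘(ℂ) (𝓘(ℂ).prod 𝓘(ℂ, F)) ω (fun x ↦ TotalSpace.mk' F x (s x)) p)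
    (h : ordAt F s p = 0) : localRep F s p (chartAt ℂ p p) ≠ 0 ∧ s p ≠ 0 := by
  have ha := contMDiffAt_section_iff_analyticAt_localRep.1 hs
  have h1 : localRep F s p (chartAt ℂ p p) ≠ 0 := by
    rw [← ha.analyticOrderAt_eq_zero]
    rw [ordAt, ha.meromorphicOrderAt_eq] at h
    cases h' : analyticOrderAt (localRep F s p) (chartAt ℂ p p) with
    | top => simp [h'] at h
    | coe n => rw [h'] at h; simpa using h
  refine ⟨h1, fun h0 ↦ h1 ?_⟩
  rw [localRep_self, h0]
  exact ((trivializationAt F E p).linear ℂ (mem_baseSet_trivializationAt F E p)).map_zero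

/-- A meromorphic function of nonnegative order agrees off the point with an analytic one. -/
theorem exists_analyticAt_of_meromorphicOrderAt_nonneg {f : ℂ → F} {c : ℂ}
    (hf : MeromorphicAt f c) (h : 0 ≤ meromorphicOrderAt f c) :
    ∃ g : ℂ → F, AnalyticAt ℂ g c ∧ f =ᶠ[𝓝[≠] c] g :=
  ⟨toMeromorphicNFAt f c,
    meromorphicNFAt_toMeromorphicNFAt.meromorphicOrderAt_nonneg_iff_analyticAt.1
      (by rwa [← meromorphicOrderAt_congr hf.eq_nhdsNE_toMeromorphicNFAt]),
    hf.eq_nhdsNE_toMeromorphicNFAt⟩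

end LocalRep

/-! ### Products and quotients by sections of a line bundle -/

section TensorSections

variable {M : Type*} [TopologicalSpace M]
  {F : Type*} [NormedAddCommGroup F] [NormedSpace ℂ F]
  {E : M → Type*} [∀ x, AddCommGroup (E x)] [∀ x, Module ℂ (E x)]
  [TopologicalSpace (TotalSpace F E)] [∀ x, TopologicalSpace (E x)]
  [FiberBundle F E] [VectorBundle ℂ F E]
  {L : M → Type*} [∀ x, AddCommGroup (L x)] [∀ x, Module ℂ (L x)]
  [TopologicalSpace (TotalSpace ℂ L)] [∀ x, TopologicalSpace (L x)]
  [FiberBundle ℂ L] [VectorBundle ℂ ℂ L]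

variable (F E) in
/-- The linear map `v ↦ v ⊗ w` for a fixed vector `w` of the fibre of `L`. -/
noncomputable def TensorLine.tmulRight {x : M} (w : L x) : E x →ₗ[ℂ] TensorLine F E L x :=
  (TensorProduct.mk ℂ (E x) (L x)).flip w

/-- Division of an element of `E x ⊗ L x` by a vector of the line `L x`. -/
noncomputable def TensorLine.div {x : M} (t : TensorLine F E L x) (w : L x) : E x :=
  (trivializationAt F E x).symm x (((trivializationAt ℂ L x ⟨x, w⟩).2)⁻¹ •
    TensorLine.coord (trivializationAt F E x) (trivializationAt ℂ L x) x t)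

theorem Bundle.Trivialization.apply_ne_zero {e : Trivialization F (π F E)} [e.IsLinear ℂ] {x : M}
    (hx : x ∈ e.baseSet) {v : E x} (hv : v ≠ 0) : (e ⟨x, v⟩).2 ≠ 0 := by
  intro h
  refine hv ?_
  have h1 := e.symm_apply_apply_mk hx v
  rw [h, ← e.symmₗ_apply (R := ℂ) hx, map_zero] at h1
  exact h1.symm

theorem TensorLine.coord_tmul_of_mem (e : Trivialization F (π F E)) (l : Trivialization ℂ (π ℂ L))
    [e.IsLinear ℂ] [l.IsLinear ℂ] {x : M} (hx : x ∈ e.baseSet) (hx' : x ∈ l.baseSet)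
    (v : E x) (w : L x) :
    TensorLine.coord e l x (TensorLine.tmul F v w) = (l ⟨x, w⟩).2 • (e ⟨x, v⟩).2 := by
  rw [TensorLine.coord_tmul, e.coe_linearMapAt_of_mem hx, l.coe_linearMapAt_of_mem hx']

/-- Because the fibre of `L` is a line, a nonzero `w` has an invertible coordinate and every tensor
is pure with second factor `w`. -/
theorem TensorLine.tmul_div {x : M} (t : TensorLine F E L x) {w : L x} (hw : w ≠ 0) :
    TensorLine.tmul F (TensorLine.div t w) w = t := by
  have hE := mem_baseSet_trivializationAt F E x
  have hL := mem_baseSet_trivializationAt ℂ L x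
  rw [← TensorLine.tmul_coord _ _ hE hL (TensorLine.tmul F (TensorLine.div t w) w),
    TensorLine.coord_tmul_of_mem _ _ hE hL, TensorLine.div, Trivialization.apply_mk_symm _ hE,
    smul_smul, mul_inv_cancel₀ (Trivialization.apply_ne_zero hL hw), one_smul,
    TensorLine.tmul_coord _ _ hE hL]

theorem TensorLine.tmul_eq_zero {x : M} {v : E x} {w : L x} (hw : w ≠ 0)
    (h : TensorLine.tmul F v w = 0) : v = 0 := by
  have hE := mem_baseSet_trivializationAt F E x
  have hL := mem_baseSet_trivializationAt ℂ L x
  have h1 := TensorLine.coord_tmul_of_mem _ _ hE hL v w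
  rw [h, map_zero] at h1
  by_contra hv
  exact smul_ne_zero (Trivialization.apply_ne_zero hL hw) (Trivialization.apply_ne_zero hE hv)
    h1.symm

theorem TensorLine.trivializationAt_apply (p : M) {x : M} (t : TensorLine F E L x) :
    (trivializationAt F (TensorLine F E L) p ⟨x, t⟩).2 =
      TensorLine.coord (trivializationAt F E p) (trivializationAt ℂ L p) x t := rfl

variable [ChartedSpace ℂ M]

theorem eventually_mem_baseSet_trivializationAt (p : M) :
    ∀ᶠ z in 𝓝 (chartAt ℂ p p), (chartAt ℂ p).symm z ∈ (trivializationAt F E p).baseSet :=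
  (tendsto_chartAt_symm p).eventually
    ((trivializationAt F E p).open_baseSet.mem_nhds (mem_baseSet_trivializationAt F E p))

theorem localRep_tmul (s : ∀ x, E x) (t : ∀ x, L x) (p : M) :
    localRep F (fun x ↦ TensorLine.tmul F (s x) (t x)) p =ᶠ[𝓝 (chartAt ℂ p p)]
      localRep ℂ t p • localRep F s p := by
  filter_upwards [eventually_mem_baseSet_trivializationAt (F := F) (E := E) p,
    eventually_mem_baseSet_trivializationAt (F := ℂ) (E := L) p] with z hz hz'
  simp only [localRep, TensorLine.trivializationAt_apply, Pi.smul_apply']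
  exact TensorLine.coord_tmul_of_mem _ _ hz hz' _ _

/-- `TensorLine.div` divides in the frames at the moving point, the local representative uses the
frames at `p`. The two agree because the quotient is characterised, independently of frames, by
giving back `t` when tensored with `w`. -/
theorem localRep_div {t : ∀ x, TensorLine F E L x} {w : ∀ x, L x} {p : M}
    {l : Filter ℂ} (hl : l ≤ 𝓝 (chartAt ℂ p p)) (hw : ∀ᶠ z in l, w ((chartAt ℂ p).symm z) ≠ 0) :
    localRep F (fun x ↦ TensorLine.div (t x) (w x)) p =ᶠ[l]
      (localRep ℂ w p)⁻¹ • localRep F t p := by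
  filter_upwards [hl (eventually_mem_baseSet_trivializationAt (F := F) (E := E) p),
    hl (eventually_mem_baseSet_trivializationAt (F := ℂ) (E := L) p), hw] with z hz hz' hwz
  simp only [localRep, TensorLine.trivializationAt_apply, Pi.smul_apply', Pi.inv_apply]
  conv_rhs => rw [← TensorLine.tmul_div (t ((chartAt ℂ p).symm z)) hwz]
  rw [TensorLine.coord_tmul_of_mem _ _ hz hz', smul_smul,
    inv_mul_cancel₀ (Trivialization.apply_ne_zero hz' hwz), one_smul]

theorem ordAt_tmul {s : ∀ x, E x} {t : ∀ x, L x} {p : M}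
    (hs : MeromorphicAt (localRep F s p) (chartAt ℂ p p))
    (ht : MeromorphicAt (localRep ℂ t p) (chartAt ℂ p p)) :
    ordAt F (fun x ↦ TensorLine.tmul F (s x) (t x)) p = ordAt ℂ t p + ordAt F s p := by
  rw [ordAt, meromorphicOrderAt_congr ((localRep_tmul s t p).filter_mono nhdsWithin_le_nhds),
    meromorphicOrderAt_smul ht hs]
  rfl

theorem contMDiffAt_tmul [CompleteSpace F] {s : ∀ x, E x} {t : ∀ x, L x} {p : M}
    (hs : ContMDiffAt 𝓘(ℂ) (𝓘(ℂ).prod 𝓘(ℂ, F)) ω (fun x ↦ TotalSpace.mk' F x (s x)) p)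
    (ht : ContMDiffAt 𝓘(ℂ) (𝓘(ℂ).prod 𝓘(ℂ, ℂ)) ω (fun x ↦ TotalSpace.mk' ℂ x (t x)) p) :
    ContMDiffAt 𝓘(ℂ) (𝓘(ℂ).prod 𝓘(ℂ, F)) ω
      (fun x ↦ TotalSpace.mk' F x (TensorLine.tmul F (s x) (t x))) p := by
  rw [contMDiffAt_section_iff_analyticAt_localRep (s := fun x ↦ TensorLine.tmul F (s x) (t x))]
  rw [contMDiffAt_section_iff_analyticAt_localRep] at hs ht
  exact (ht.smul hs).congr (localRep_tmul s t p).symm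

/-- If the order of `t` is everywhere at least that of the meromorphic section `w` of a line
bundle, the quotient `t / w` extends to a holomorphic section. -/
theorem exists_holomorphicSections_tmul_eq [CompleteSpace F] {S : Set M} (hS : IsClosed S)
    (hd : ∀ p, ∀ᶠ x in 𝓝[≠] p, x ∉ S) {w : ∀ x, L x} (hw : IsMeromorphicSection ℂ w)
    (hw0 : ∀ p ∉ S, ordAt ℂ w p = 0) (hwtop : ∀ p, ordAt ℂ w p ≠ ⊤) {t : ∀ x, TensorLine F E L x}
    (ht : ∀ p ∉ S, ContMDiffAt 𝓘(ℂ) (𝓘(ℂ).prod 𝓘(ℂ, F)) ω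
      (fun x ↦ TotalSpace.mk' F x (t x)) p)
    (htm : ∀ p, MeromorphicAt (localRep F t p) (chartAt ℂ p p))
    (hord : ∀ p, ordAt ℂ w p ≤ ordAt F t p) :
    ∃ s ∈ holomorphicSections F E ⊤, ∀ x ∉ S, t x = TensorLine.tmul F (s x) (w x) := by
  have hne : ∀ p ∉ S, localRep ℂ w p (chartAt ℂ p p) ≠ 0 ∧ w p ≠ 0 := fun p hp ↦
    ne_zero_of_ordAt_eq_zero ((hw p).2 (hw0 p hp).ge) (hw0 p hp)
  suffices h : ∃ s ∈ holomorphicSections F E ⊤, ∀ x ∉ S, s x = TensorLine.div (t x) (w x) by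
    obtain ⟨s, hs, hse⟩ := h
    refine ⟨s, hs, fun x hx ↦ ?_⟩
    rw [hse x hx, TensorLine.tmul_div _ (hne x hx).2]
  refine exists_holomorphicSections_of_analyticAt hS hd (fun p hp ↦ ?_) (fun p hp ↦ ?_)
  · have hwa := contMDiffAt_section_iff_analyticAt_localRep.1 ((hw p).2 (hw0 p hp).ge)
    have hta := contMDiffAt_section_iff_analyticAt_localRep.1 (ht p hp)
    refine ((hwa.inv (hne p hp).1).smul hta).congr (localRep_div le_rfl ?_).symm
    filter_upwards [(tendsto_chartAt_symm p).eventually (hS.isOpen_compl.mem_nhds hp)] with z hz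
    exact (hne _ hz).2
  · have h1 := localRep_div (t := t) (w := w) (p := p) nhdsWithin_le_nhds
      ((tendsto_chartAt_symm_punctured p).eventually ((hd p).mono fun x hx ↦ (hne x hx).2))
    have hm : MeromorphicAt ((localRep ℂ w p)⁻¹ • localRep F t p) (chartAt ℂ p p) :=
      (hw p).1.inv.smul (htm p)
    -- The order of the quotient is `ord t - ord w`. Finiteness of `ord w` makes the subtraction
    -- legitimate, while `ord t` may be infinite.
    have ho : 0 ≤ meromorphicOrderAt ((localRep ℂ w p)⁻¹ • localRep F t p) (chartAt ℂ p p) := by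
      rw [meromorphicOrderAt_smul (hw p).1.inv (htm p), meromorphicOrderAt_inv]
      have h2 := hord p
      have h3 := hwtop p
      simp only [ordAt] at h2 h3
      generalize meromorphicOrderAt (localRep ℂ w p) (chartAt ℂ p p) = a at h2 h3 ⊢
      generalize meromorphicOrderAt (localRep F t p) (chartAt ℂ p p) = b at h2 ⊢
      lift a to ℤ using h3
      induction b with
      | top => simp
      | coe b =>
        have h2' : a ≤ b := by exact_mod_cast h2
        have : ((0 : ℤ) : WithTop ℤ) ≤ ((-a + b : ℤ) : WithTop ℤ) :=
          WithTop.coe_le_coe.2 (by omega)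
        exact_mod_cast this
    obtain ⟨g, hg, hge⟩ := exists_analyticAt_of_meromorphicOrderAt_nonneg hm ho
    exact ⟨g, hg, h1.trans hge⟩

end TensorSections

/-! ### Hermitian metrics in local frames -/

section LocalMetric

variable {M : Type*} [TopologicalSpace M]
  {F : Type*} [NormedAddCommGroup F] [NormedSpace ℂ F]
  {E : M → Type*} [∀ x, AddCommGroup (E x)] [∀ x, Module ℂ (E x)]
  [TopologicalSpace (TotalSpace F E)] [∀ x, TopologicalSpace (E x)]
  [FiberBundle F E] [VectorBundle ℂ F E]
  {L : M → Type*} [∀ x, AddCommGroup (L x)] [∀ x, Module ℂ (L x)]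
  [TopologicalSpace (TotalSpace ℂ L)] [∀ x, TopologicalSpace (L x)]
  [FiberBundle ℂ L] [VectorBundle ℂ ℂ L]

theorem HermitianMetric.normSq_tensor_tmul (h : HermitianMetric F E) (κ : HermitianMetric ℂ L)
    (x : M) (v : E x) (w : L x) :
    (h.tensor κ).normSq x (TensorLine.tmul F v w) = h.normSq x v * κ.normSq x w := by
  have him : (h.form x v v).im = 0 := Complex.conj_eq_iff_im.1 (h.conj_symm x v v)
  change (h.tensorForm κ x (TensorLine.tmul F v w) (TensorLine.tmul F v w)).re = _
  rw [HermitianMetric.tensorForm_tmul, Complex.mul_re, him, zero_mul, sub_zero]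
  rfl

theorem HermitianMetric.normSq_pos (h : HermitianMetric F E) {x : M} {v : E x} (hv : v ≠ 0) :
    0 < h.normSq x v := h.pos x v hv

variable [FiniteDimensional ℂ F]

/-- Expanding in a basis of the finite-dimensional model fibre reduces joint continuity in point and
vector to continuity of the finitely many matrix coefficients of the metric. -/
theorem HermitianMetric.continuousOn_normSq_symm (h : HermitianMetric F E) (p : M) :
    ContinuousOn (fun q : M × F ↦ h.normSq q.1 ((trivializationAt F E p).symm q.1 q.2))
      ((trivializationAt F E p).baseSet ×ˢ Set.univ) := by
  let b := Module.finBasis ℂ F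
  have hsum : ContinuousOn (fun q : M × F ↦ (∑ i, ∑ j, conj (b.repr q.2 i) * (b.repr q.2 j *
      h.form q.1 ((trivializationAt F E p).symm q.1 (b i))
        ((trivializationAt F E p).symm q.1 (b j)))).re)
      ((trivializationAt F E p).baseSet ×ˢ Set.univ) := by
    refine Complex.continuous_re.comp_continuousOn ?_
    have hb : ∀ i, Continuous fun q : M × F ↦ b.repr q.2 i := fun i ↦
      (LinearMap.continuous_of_finiteDimensional (b.coord i)).comp continuous_snd
    refine continuousOn_finsetSum _ fun i _ ↦ continuousOn_finsetSum _ fun j _ ↦ ?_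
    refine (Complex.continuous_conj.comp (hb i)).continuousOn.mul ((hb j).continuousOn.mul ?_)
    exact (h.continuous p (b i) (b j)).comp continuousOn_fst fun q hq ↦ hq.1
  refine hsum.congr fun q hq ↦ ?_
  have h1 : (trivializationAt F E p).symm q.1 q.2 =
      ∑ i, b.repr q.2 i • (trivializationAt F E p).symm q.1 (b i) := by
    conv_lhs => rw [← b.sum_repr q.2]
    rw [← (trivializationAt F E p).symmₗ_apply (R := ℂ) hq.1, map_sum]
    refine Finset.sum_congr rfl fun i _ ↦ ?_
    rw [map_smul, (trivializationAt F E p).symmₗ_apply (R := ℂ) hq.1]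
  simp only [HermitianMetric.normSq]
  congr 1
  rw [h1]
  simp only [map_sum, LinearMap.sum_apply, map_smulₛₗ, LinearMap.smul_apply, smul_eq_mul,
    Finset.mul_sum, RingHom.id_apply]
  rw [Finset.sum_comm]
  exact Finset.sum_congr rfl fun i _ ↦ Finset.sum_congr rfl fun j _ ↦ by ring

theorem HermitianMetric.continuousAt_normSq [ChartedSpace ℂ M] (h : HermitianMetric F E)
    {s : ∀ x, E x} {p : M}
    (hs : ContMDiffAt 𝓘(ℂ) (𝓘(ℂ).prod 𝓘(ℂ, F)) ω (fun x ↦ TotalSpace.mk' F x (s x)) p) :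
    ContinuousAt (fun x ↦ h.normSq x (s x)) p := by
  have hc := ((contMDiffAt_section p).1 hs).continuousAt
  have hb : (trivializationAt F E p).baseSet ∈ 𝓝 p :=
    (trivializationAt F E p).open_baseSet.mem_nhds (mem_baseSet_trivializationAt F E p)
  have hj : ContinuousAt (fun q : M × F ↦ h.normSq q.1 ((trivializationAt F E p).symm q.1 q.2))
      (p, (trivializationAt F E p ⟨p, s p⟩).2) :=
    (h.continuousOn_normSq_symm p).continuousAt (prod_mem_nhds hb univ_mem)
  have := ContinuousAt.comp (f := fun x ↦ (x, (trivializationAt F E p ⟨x, s x⟩).2)) (x := p) hj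
    (continuousAt_id.prodMk hc)
  refine this.congr ?_
  filter_upwards [hb] with x hx
  simp only [Function.comp_apply]
  rw [(trivializationAt F E p).symm_apply_apply_mk hx (s x)]

/-- In a local frame, a Hermitian metric is locally bounded below by a multiple of the norm. -/
theorem HermitianMetric.exists_le_normSq_symm (h : HermitianMetric F E) (p : M) :
    ∃ c : ℝ, 0 < c ∧ ∀ᶠ x in 𝓝 p, ∀ v : F,
      c * ‖v‖ ^ 2 ≤ h.normSq x ((trivializationAt F E p).symm x v) := by
  have : ProperSpace F := FiniteDimensional.proper ℂ F
  have hbp := mem_baseSet_trivializationAt F E p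
  have hb : (trivializationAt F E p).baseSet ∈ 𝓝 p :=
    (trivializationAt F E p).open_baseSet.mem_nhds hbp
  let K : Set F := Metric.sphere 0 1
  have hK : IsCompact K := isCompact_sphere 0 1
  let f : M × F → ℝ := fun q ↦ h.normSq q.1 ((trivializationAt F E p).symm q.1 q.2)
  have hf : ∀ v, ContinuousAt f (p, v) := fun v ↦
    (h.continuousOn_normSq_symm p).continuousAt (prod_mem_nhds hb univ_mem)
  have hpos : ∀ v ∈ K, 0 < f (p, v) := by
    intro v hv
    refine h.normSq_pos fun h0 ↦ ?_
    have h1 := (trivializationAt F E p).apply_mk_symm hbp v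
    rw [h0] at h1
    have h2 := ((trivializationAt F E p).linear ℂ hbp).map_zero
    rw [h1] at h2
    simp only at h2
    rw [mem_sphere_zero_iff_norm, h2, norm_zero] at hv
    exact zero_ne_one hv
  -- Half the minimum over the unit sphere leaves a strict inequality, an open condition that
  -- compactness spreads to nearby points uniformly in `v`. The sphere is empty when `F` is trivial,
  -- and then any constant serves.
  obtain ⟨c, hc, hcK⟩ : ∃ c : ℝ, 0 < c ∧ ∀ v ∈ K, c < f (p, v) := by
    rcases K.eq_empty_or_nonempty with hKe | hKn
    · exact ⟨1, one_pos, fun v hv ↦ by simp [hKe] at hv⟩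
    · obtain ⟨v₀, hv₀, hmin⟩ := hK.exists_isMinOn hKn (f := fun v ↦ f (p, v)) fun v _ ↦
        ((hf v).comp (f := fun v : F ↦ (p, v)) (by fun_prop)).continuousWithinAt
      exact ⟨f (p, v₀) / 2, half_pos (hpos v₀ hv₀), fun v hv ↦
        (half_lt_self (hpos v₀ hv₀)).trans_le (hmin hv)⟩
  refine ⟨c, hc, ?_⟩
  have hev : ∀ᶠ x in 𝓝 p, ∀ v ∈ K, c < f (x, v) :=
    hK.eventually_forall_of_forall_eventually fun v hv ↦
      (hf v).eventually (lt_mem_nhds (hcK v hv))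
  filter_upwards [hev, hb] with x hx hxb v
  by_cases hv : v = 0
  · simp only [hv, norm_zero, ne_eq, OfNat.ofNat_ne_zero, not_false_eq_true, zero_pow, mul_zero]
    exact h.normSq_nonneg _ _
  have hn : 0 < ‖v‖ := norm_pos_iff.2 hv
  have h1 := hx (((‖v‖⁻¹ : ℝ) : ℂ) • v) (by
    rw [mem_sphere_zero_iff_norm, norm_smul]
    simp [hn.ne'])
  simp only [f] at h1
  rw [← (trivializationAt F E p).symmₗ_apply (R := ℂ) hxb, map_smul, h.normSq_smul,
    (trivializationAt F E p).symmₗ_apply (R := ℂ) hxb] at h1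
  simp only [Complex.norm_real, norm_inv, norm_norm, inv_pow] at h1
  rw [lt_inv_mul_iff₀ (by positivity)] at h1
  linarith

end LocalMetric

/-! ### Square integrable sections -/

section SquareIntegrable

/-- Near `p` only finitely many support points occur; those other than `p` form a closed set and can
be avoided. -/
theorem Function.locallyFinsupp.eventually_notMem_support {X : Type*} [TopologicalSpace X]
    [T1Space X] (D : Function.locallyFinsupp X ℤ) (p : X) : ∀ᶠ x in 𝓝[≠] p, x ∉ D.support := by
  obtain ⟨t, ht, hfin⟩ := D.supportLocallyFiniteWithinDomain p (Set.mem_univ p)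
  have hfin' : ((t ∩ D.support) \ {p}).Finite := hfin.subset Set.sdiff_subset
  have hmem : ((t ∩ D.support) \ {p})ᶜ ∈ 𝓝 p :=
    hfin'.isClosed.isOpen_compl.mem_nhds fun h ↦ h.2 rfl
  filter_upwards [self_mem_nhdsWithin, mem_nhdsWithin_of_mem_nhds ht,
    mem_nhdsWithin_of_mem_nhds hmem] with x hxp hxt hx hxD
  exact hx ⟨⟨hxt, hxD⟩, hxp⟩

/-- A linear equivalence between two spaces of sections, from a fibrewise linear relation between
them that holds on a set of points determining the sections. -/
theorem Submodule.exists_linearEquiv_of_forall_mem {M : Type*} {E E' : M → Type*}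
    [∀ x, AddCommGroup (E x)] [∀ x, Module ℂ (E x)] [∀ x, AddCommGroup (E' x)]
    [∀ x, Module ℂ (E' x)] (V : Submodule ℂ (∀ x, E x)) (W : Submodule ℂ (∀ x, E' x))
    (T : ∀ x, E x →ₗ[ℂ] E' x) (A : Set M)
    (hVW : ∀ s ∈ V, ∃ w ∈ W, ∀ x ∈ A, w x = T x (s x))
    (hWV : ∀ w ∈ W, ∃ s ∈ V, ∀ x ∈ A, w x = T x (s x))
    (hW : ∀ w ∈ W, (∀ x ∈ A, w x = 0) → w = 0)
    (hV : ∀ s ∈ V, (∀ x ∈ A, T x (s x) = 0) → s = 0) :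
    ∃ Φ : V ≃ₗ[ℂ] W, ∀ s, ∀ x ∈ A, (Φ s).1 x = T x (s.1 x) := by
  -- The images are chosen arbitrarily; since elements of `W` are determined on `A`, the choice is
  -- forced, and linearity follows from that of `T`.
  choose! f hf hfe using hVW
  have huniq : ∀ w ∈ W, ∀ w' ∈ W, (∀ x ∈ A, w x = w' x) → w = w' := fun w hw w' hw' h ↦
    sub_eq_zero.1 (hW _ (sub_mem hw hw') fun x hx ↦ by simp [h x hx])
  let Φ : V →ₗ[ℂ] W :=
    { toFun s := ⟨f s.1, hf _ s.2⟩
      map_add' s t := Subtype.ext (huniq _ (hf _ (s + t).2) _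
        (add_mem (hf _ s.2) (hf _ t.2)) fun x hx ↦ by
          change f (s + t).1 x = f s.1 x + f t.1 x
          rw [hfe _ (s + t).2 x hx, hfe _ s.2 x hx, hfe _ t.2 x hx]
          exact map_add _ _ _)
      map_smul' c s := Subtype.ext (huniq _ (hf _ (c • s).2) _
        (W.smul_mem c (hf _ s.2)) fun x hx ↦ by
          change f (c • s).1 x = c • f s.1 x
          rw [hfe _ (c • s).2 x hx, hfe _ s.2 x hx]
          exact map_smul _ _ _) }
  refine ⟨LinearEquiv.ofBijective Φ ⟨?_, ?_⟩, fun s x hx ↦ hfe _ s.2 x hx⟩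
  · rw [← LinearMap.ker_eq_bot, LinearMap.ker_eq_bot']
    intro s hs
    refine Subtype.ext (hV _ s.2 fun x hx ↦ ?_)
    rw [← hfe _ s.2 x hx]
    exact congrFun (congrArg Subtype.val hs) x
  · intro w
    obtain ⟨s, hs, hse⟩ := hWV w.1 w.2
    refine ⟨⟨s, hs⟩, Subtype.ext (huniq _ (hf _ hs) _ w.2 fun x hx ↦ ?_)⟩
    rw [hfe _ hs x hx, hse x hx]

variable {M : Type*} [TopologicalSpace M] [ChartedSpace ℂ M] [MeasurableSpace M] [BorelSpace M]
  {F : Type*} [NormedAddCommGroup F] [NormedSpace ℂ F] [FiniteDimensional ℂ F]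
  {E : M → Type*} [∀ x, AddCommGroup (E x)] [∀ x, Module ℂ (E x)]
  [TopologicalSpace (TotalSpace F E)] [∀ x, TopologicalSpace (E x)]
  [FiberBundle F E] [VectorBundle ℂ F E]
  {L : M → Type*} [∀ x, AddCommGroup (L x)] [∀ x, Module ℂ (L x)]
  [TopologicalSpace (TotalSpace ℂ L)] [∀ x, TopologicalSpace (L x)]
  [FiberBundle ℂ L] [VectorBundle ℂ ℂ L]

/-- No measurability of `k` is needed because the density is measurable and finite everywhere. -/
theorem TwoForm.setLIntegral_smul {θ : TwoForm M} (hθ : θ.IsPositiveContinuous) {S : Set M}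
    (hS : IsClosed S) (hd : ∀ p, ∀ᶠ x in 𝓝[≠] p, x ∉ S) {g : M → ℝ}
    (hgc : ContinuousOn g Sᶜ) (hg0 : ∀ x ∉ S, 0 < g x) {A : Set M} (hA : MeasurableSet A)
    (hAS : A ⊆ Sᶜ) (k : M → ℝ≥0∞) :
    ∫⁻ x in A, k x ∂TwoForm.measure (fun x ↦ g x • θ x) =
      ∫⁻ x in A, ENNReal.ofReal (g x) * k x ∂θ.measure := by
  rw [TwoForm.measure_smul hθ hS hd hgc hg0]
  rw [setLIntegral_withDensity_eq_setLIntegral_mul_non_measurable _ ?_ _ hA]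
  · refine setLIntegral_congr_fun hA fun x hx ↦ ?_
    simp only [Pi.mul_apply]
    rw [Set.indicator_of_mem (hAS hx)]
  · refine Eventually.of_forall fun x ↦ ?_
    by_cases hx : x ∈ Sᶜ <;> simp [hx]
  · classical
    rw [← Set.piecewise_eq_indicator]
    refine ContinuousOn.measurable_piecewise ?_ continuousOn_const hS.isOpen_compl.measurableSet
    exact ENNReal.continuous_ofReal.comp_continuousOn hgc

theorem HermitianMetric.continuousOn_normSq_of_contMDiffAt (h : HermitianMetric F E)
    {s : ∀ x, E x} {A : Set M} (hs : ∀ x ∈ A,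
      ContMDiffAt 𝓘(ℂ) (𝓘(ℂ).prod 𝓘(ℂ, F)) ω (fun x ↦ TotalSpace.mk' F x (s x)) x) :
    ContinuousOn (fun x ↦ h.normSq x (s x)) A :=
  fun x hx ↦ (h.continuousAt_normSq (hs x hx)).continuousWithinAt

/-- Removable singularities of square integrable holomorphic sections. -/
theorem exists_analyticAt_localRep_of_lintegral_lt_top [IsManifold 𝓘(ℂ) ω M]
    [ContMDiffVectorBundle ω F E 𝓘(ℂ)] {vol : TwoForm M} (hvol : vol.IsPositiveContinuous)
    (h : HermitianMetric F E) {t : ∀ x, E x} {p : M} {A : Set M} (hA : IsOpen A)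
    (hAp : ∀ᶠ x in 𝓝[≠] p, x ∈ A) (ht : ∀ x ∈ A,
      ContMDiffAt 𝓘(ℂ) (𝓘(ℂ).prod 𝓘(ℂ, F)) ω (fun x ↦ TotalSpace.mk' F x (t x)) x)
    (hi : ∫⁻ x in A, ENNReal.ofReal (h.normSq x (t x)) ∂vol.measure < ⊤) :
    ∃ g : ℂ → F, AnalyticAt ℂ g (chartAt ℂ p p) ∧
      localRep F t p =ᶠ[𝓝[≠] (chartAt ℂ p p)] g := by
  have : CompleteSpace F := FiniteDimensional.complete ℂ F
  set φ := chartAt ℂ p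
  have hpt : φ p ∈ φ.target := mem_chart_target ℂ p
  have hdens := hvol φ (chart_mem_atlas ℂ p)
  obtain ⟨c₂, hc₂, hle⟩ := h.exists_le_normSq_symm p
  -- Near `p`, `c₁` bounds the volume density from below and `c₂` the metric in the frame; together
  -- they compare the invariant integral with the Lebesgue integral of the squared local
  -- representative.
  set c₁ := vol.density φ (φ p) / 2
  have hc₁ : 0 < c₁ := half_pos (hdens.2 _ hpt)
  have hev₁ : ∀ᶠ z in 𝓝 (φ p), c₁ ≤ vol.density φ z :=
    (hdens.1.continuousAt (φ.open_target.mem_nhds hpt)).eventually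
      (le_mem_nhds (half_lt_self (hdens.2 _ hpt)))
  have hgood : ∀ᶠ z in 𝓝[≠] (φ p), (z ∈ φ.target ∧ φ.symm z ∈ A) ∧
      φ.symm z ∈ (trivializationAt F E p).baseSet ∧ c₁ ≤ vol.density φ z ∧
      c₂ * ‖localRep F t p z‖ ^ 2 ≤ h.normSq (φ.symm z) (t (φ.symm z)) := by
    filter_upwards [mem_nhdsWithin_of_mem_nhds (φ.open_target.mem_nhds hpt),
      (tendsto_chartAt_symm_punctured p).eventually hAp, nhdsWithin_le_nhds hev₁,
      nhdsWithin_le_nhds (eventually_mem_baseSet_trivializationAt (F := F) (E := E) p),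
      nhdsWithin_le_nhds ((tendsto_chartAt_symm p).eventually hle)] with z h1 h2 h3 h4 h5
    refine ⟨⟨h1, h2⟩, h4, h3, ?_⟩
    have h6 := h5 (localRep F t p z)
    have h7 : (trivializationAt F E p).symm (φ.symm z) (localRep F t p z) = t (φ.symm z) :=
      (trivializationAt F E p).symm_apply_apply_mk h4 _
    rwa [h7] at h6
  obtain ⟨R, hR, hRs⟩ := (nhdsWithin_hasBasis Metric.nhds_basis_ball _).mem_iff.1 hgood
  set N : Set ℂ := Metric.ball (φ p) R ∩ {φ p}ᶜ
  have hNm : MeasurableSet N :=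
    Metric.isOpen_ball.measurableSet.inter (measurableSet_singleton _).compl
  refine exists_analyticAt_of_lintegral_enorm_sq_lt_top (N := N)
    (inter_mem (mem_nhdsWithin_of_mem_nhds (Metric.ball_mem_nhds _ hR)) self_mem_nhdsWithin)
    (hgood.mono fun z hz ↦ differentiableAt_localRep hz.1.1 hz.2.1 (ht _ hz.1.2)) ?_
  set k : M → ℝ≥0∞ := fun x ↦ ENNReal.ofReal (h.normSq x (t x))
  set ν := (volume.restrict φ.target).withDensity fun z ↦ ENNReal.ofReal (vol.density φ z)
  have hdm : AEMeasurable (fun z ↦ ENNReal.ofReal (vol.density φ z))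
      (volume.restrict φ.target) :=
    (hdens.1.aemeasurable φ.open_target.measurableSet).ennreal_ofReal
  have hsm : AEMeasurable φ.symm ν := aemeasurable_chart_symm φ _
  have hkm : AEMeasurable k ((ν.map φ.symm).restrict A) :=
    ((h.continuousOn_normSq_of_contMDiffAt ht).aemeasurable hA.measurableSet).ennreal_ofReal
  -- An inequality suffices, so it is enough that the global measure dominates the measure of this
  -- one chart.
  have h1 : ∫⁻ z in N, ENNReal.ofReal (vol.density φ z) * k (φ.symm z) ≤
      ∫⁻ x in A, k x ∂vol.measure := by
    calc ∫⁻ z in N, ENNReal.ofReal (vol.density φ z) * k (φ.symm z)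
        = ∫⁻ z in N, k (φ.symm z) ∂ν := by
          rw [setLIntegral_withDensity_eq_setLIntegral_mul_non_measurable₀ _ hdm.restrict _ hNm
            (Eventually.of_forall fun _ ↦ ENNReal.ofReal_lt_top), Measure.restrict_restrict hNm,
            Set.inter_eq_left.2 fun z hz ↦ (hRs hz).1.1]
          rfl
      _ ≤ ∫⁻ z in φ.symm ⁻¹' A, k (φ.symm z) ∂ν := lintegral_mono_set fun z hz ↦ (hRs hz).1.2
      _ = ∫⁻ x in A, k x ∂(ν.map φ.symm) := by
          rw [Measure.restrict_map_of_aemeasurable hsm hA.measurableSet] at hkm ⊢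
          rw [lintegral_map' hkm (hsm.mono_measure Measure.restrict_le_self)]
      _ ≤ ∫⁻ x in A, k x ∂vol.measure := by
          refine lintegral_mono' (Measure.restrict_mono le_rfl ?_) le_rfl
          exact le_iSup (fun φ : atlas ℂ M ↦ vol.chartMeasure φ.1) ⟨φ, chart_mem_atlas ℂ p⟩
  have h2 : ENNReal.ofReal (c₁ * c₂) * ∫⁻ z in N, ‖localRep F t p z‖ₑ ^ 2 ≤
      ∫⁻ z in N, ENNReal.ofReal (vol.density φ z) * k (φ.symm z) := by
    rw [← lintegral_const_mul' _ _ ENNReal.ofReal_ne_top]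
    refine setLIntegral_mono' hNm fun z hz ↦ ?_
    obtain ⟨-, -, h3, h4⟩ := hRs hz
    rw [← ofReal_norm, ← ENNReal.ofReal_pow (norm_nonneg _), ENNReal.ofReal_mul hc₁.le, mul_assoc,
      ← ENNReal.ofReal_mul hc₂.le]
    gcongr
    exact ENNReal.ofReal_le_ofReal h4
  refine ENNReal.lt_top_of_mul_ne_top_right ((h2.trans h1).trans_lt hi).ne ?_
  rw [ne_eq, ENNReal.ofReal_eq_zero, not_le]
  positivity

theorem eq_zero_of_mem_holomorphicSections {S : Set M} (hd : ∀ p, ∀ᶠ x in 𝓝[≠] p, x ∉ S)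
    {s : ∀ x, E x} (hs : s ∈ holomorphicSections F E ⊤) (h : ∀ x ∉ S, s x = 0) : s = 0 := by
  have : CompleteSpace F := FiniteDimensional.complete ℂ F
  funext p
  exact eq_zero_of_eventually_punctured ((hs.2 p trivial).contMDiffAt univ_mem)
    ((hd p).mono fun x hx ↦ h x hx)

theorem compl_ae_eq_of_subset {vol : TwoForm M} {S T : Set M} (hS : IsClosed S)
    (hd : ∀ p, ∀ᶠ x in 𝓝[≠] p, x ∉ S) (hT : T ⊆ S) : (Tᶜ : Set M) =ᵐ[vol.measure] Sᶜ := by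
  have h0 := vol.measure_apply_eq_zero hS hd
  have hS' : (Sᶜ : Set M) =ᵐ[vol.measure] Set.univ := by rwa [ae_eq_univ, compl_compl]
  have hT' : (Tᶜ : Set M) =ᵐ[vol.measure] Set.univ := by
    rw [ae_eq_univ, compl_compl]
    exact measure_mono_null hT h0
  exact hT'.trans hS'.symm

/-- Multiplication by a section of a line bundle is isometric for the weighted norm. -/
theorem l2NormSq_tmul {vol : TwoForm M} (hvol : vol.IsPositiveContinuous)
    (h : HermitianMetric F E) (κ : HermitianMetric ℂ L) {S : Set M} (hS : IsClosed S)
    (hd : ∀ p, ∀ᶠ x in 𝓝[≠] p, x ∉ S) {w : ∀ x, L x} (hw : ∀ x ∉ S,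
      ContMDiffAt 𝓘(ℂ) (𝓘(ℂ).prod 𝓘(ℂ, ℂ)) ω (fun x ↦ TotalSpace.mk' ℂ x (w x)) x)
    (hw0 : ∀ x ∉ S, w x ≠ 0) {s : ∀ x, E x} {t : ∀ x, TensorLine F E L x}
    (ht : ∀ x ∉ S, t x = TensorLine.tmul F (s x) (w x)) :
    l2NormSq ⊤ ∅ vol (h.tensor κ) t = l2NormSq ⊤ S (κ.weight w vol) h s := by
  have hA : ((⊤ : Opens M) : Set M) \ S = Sᶜ := by simp [Set.compl_eq_univ_sdiff]
  have hA' : ((⊤ : Opens M) : Set M) \ ∅ = ∅ᶜ := by simp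
  -- The unweighted integral runs over all of `M`; dropping the null set `S` brings both integrals
  -- to the same domain.
  rw [l2NormSq, l2NormSq, hA, hA', setLIntegral_congr (compl_ae_eq_of_subset hS hd
    (Set.empty_subset S))]
  rw [show κ.weight w vol = fun x ↦ κ.normSq x (w x) • vol x from rfl,
    TwoForm.setLIntegral_smul hvol hS hd (κ.continuousOn_normSq_of_contMDiffAt hw)
      (fun x hx ↦ κ.normSq_pos (hw0 x hx)) hS.measurableSet.compl le_rfl]
  refine setLIntegral_congr_fun hS.measurableSet.compl fun x hx ↦ ?_
  rw [ht x hx, h.normSq_tensor_tmul, mul_comm, ENNReal.ofReal_mul (κ.normSq_nonneg _ _)]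

end SquareIntegrable

/-! ### Bergman spaces with singular weights -/

section BergmanIsometries

variable {M : Type*} [TopologicalSpace M] [T2Space M] [ChartedSpace ℂ M] [IsManifold 𝓘(ℂ) ω M]
  [MeasurableSpace M] [BorelSpace M]
  {F : Type*} [NormedAddCommGroup F] [NormedSpace ℂ F] [FiniteDimensional ℂ F]
  {E : M → Type*} [∀ x, AddCommGroup (E x)] [∀ x, Module ℂ (E x)]
  [TopologicalSpace (TotalSpace F E)] [∀ x, TopologicalSpace (E x)]
  [FiberBundle F E] [VectorBundle ℂ F E] [ContMDiffVectorBundle ω F E 𝓘(ℂ)]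
  {L : M → Type*} [∀ x, AddCommGroup (L x)] [∀ x, Module ℂ (L x)]
  [TopologicalSpace (TotalSpace ℂ L)] [∀ x, TopologicalSpace (L x)]
  [FiberBundle ℂ L] [VectorBundle ℂ ℂ L] [ContMDiffVectorBundle ω ℂ L 𝓘(ℂ)]
  {Lp : M → Type*} [∀ x, AddCommGroup (Lp x)] [∀ x, Module ℂ (Lp x)]
  [TopologicalSpace (TotalSpace ℂ Lp)] [∀ x, TopologicalSpace (Lp x)]
  [FiberBundle ℂ Lp] [VectorBundle ℂ ℂ Lp] [ContMDiffVectorBundle ω ℂ Lp 𝓘(ℂ)]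
  {Lm : M → Type*} [∀ x, AddCommGroup (Lm x)] [∀ x, Module ℂ (Lm x)]
  [TopologicalSpace (TotalSpace ℂ Lm)] [∀ x, TopologicalSpace (Lm x)]
  [FiberBundle ℂ Lm] [VectorBundle ℂ ℂ Lm] [ContMDiffVectorBundle ω ℂ Lm 𝓘(ℂ)]

theorem contMDiffAt_of_mem_holomorphicSections {U : Opens M} {s : ∀ x, E x}
    (hs : s ∈ holomorphicSections F E U) {p : M} (hp : p ∈ U) :
    ContMDiffAt 𝓘(ℂ) (𝓘(ℂ).prod 𝓘(ℂ, F)) ω (fun x ↦ TotalSpace.mk' F x (s x)) p :=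
  (hs.2 p hp).contMDiffAt (U.isOpen.mem_nhds hp)

theorem IsMeromorphicSection.contMDiffAt_of_notMem {w : ∀ x, L x}
    (hw : IsMeromorphicSection ℂ w) {D : Function.locallyFinsupp M ℤ}
    (hD : ∀ p, ordAt ℂ w p = (D p : ℤ)) {p : M} (hp : p ∉ D.support) :
    ContMDiffAt 𝓘(ℂ) (𝓘(ℂ).prod 𝓘(ℂ, ℂ)) ω (fun x ↦ TotalSpace.mk' ℂ x (w x)) p := by
  refine (hw p).2 ?_
  rw [hD, Function.notMem_support.1 hp]
  exact le_rfl

theorem IsMeromorphicSection.ne_zero_of_notMem {w : ∀ x, L x}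
    (hw : IsMeromorphicSection ℂ w) {D : Function.locallyFinsupp M ℤ}
    (hD : ∀ p, ordAt ℂ w p = (D p : ℤ)) {p : M} (hp : p ∉ D.support) : w p ≠ 0 := by
  refine (ne_zero_of_ordAt_eq_zero (hw.contMDiffAt_of_notMem hD hp) ?_).2
  rw [hD, Function.notMem_support.1 hp]
  rfl

/-- The product with a meromorphic section of divisor `D` of a section that is square integrable
with respect to the corresponding weight extends holomorphically. -/
theorem exists_analyticAt_localRep_tmul {vol : TwoForm M} (hvol : vol.IsPositiveContinuous)
    (h : HermitianMetric F E) (κ : HermitianMetric ℂ L) (D : Function.locallyFinsupp M ℤ)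
    {w : ∀ x, L x} (hw : IsMeromorphicSection ℂ w) (hD : ∀ p, ordAt ℂ w p = (D p : ℤ))
    {s : ∀ x, E x} (hs : ∀ p ∉ D.support,
      ContMDiffAt 𝓘(ℂ) (𝓘(ℂ).prod 𝓘(ℂ, F)) ω (fun x ↦ TotalSpace.mk' F x (s x)) p)
    (hi : l2NormSq ⊤ D.support (κ.weight w vol) h s < ⊤) (p : M) :
    ∃ g : ℂ → F, AnalyticAt ℂ g (chartAt ℂ p p) ∧
      localRep F (fun x ↦ TensorLine.tmul F (s x) (w x)) p =ᶠ[𝓝[≠] (chartAt ℂ p p)] g := by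
  have : CompleteSpace F := FiniteDimensional.complete ℂ F
  have hS := D.closedSupport isClosed_univ
  have hd := D.eventually_notMem_support
  refine exists_analyticAt_localRep_of_lintegral_lt_top hvol (h.tensor κ) hS.isOpen_compl (hd p)
    (fun x hx ↦ contMDiffAt_tmul (hs x hx) (hw.contMDiffAt_of_notMem hD hx)) ?_
  rw [← l2NormSq_tmul hvol h κ hS hd (fun x hx ↦ hw.contMDiffAt_of_notMem hD hx)
    (fun x hx ↦ hw.ne_zero_of_notMem hD hx) fun x _ ↦ rfl] at hi
  have hsub : D.supportᶜ ⊆ ((⊤ : Opens M) : Set M) \ ∅ := fun x _ ↦ ⟨trivial, Set.notMem_empty x⟩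
  exact (lintegral_mono_set hsub).trans_lt hi

theorem ordAt_nonneg_of_eventuallyEq {t : ∀ x, E x} {p : M} {g : ℂ → F}
    (hg : AnalyticAt ℂ g (chartAt ℂ p p))
    (h : localRep F t p =ᶠ[𝓝[≠] (chartAt ℂ p p)] g) : 0 ≤ ordAt F t p := by
  rw [ordAt, meromorphicOrderAt_congr h]
  exact hg.meromorphicOrderAt_nonneg

/-- Cancellation of an order in an inequality for sums of orders. -/
theorem WithTop.neg_coe_le_of_zero_le_coe_add {a : ℤ} {b : WithTop ℤ}
    (h : 0 ≤ (a : WithTop ℤ) + b) : ((-a : ℤ) : WithTop ℤ) ≤ b := by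
  induction b with
  | top => exact le_top
  | coe b =>
    have h' : (0 : ℤ) ≤ a + b := by exact_mod_cast h
    exact WithTop.coe_le_coe.2 (by omega)

/-- The product `s ⊗ w` extends holomorphically, so `D p + ord s ≥ 0`. No sign of `D` is involved.
-/
theorem neg_le_ordAt_of_mem_bergman {vol : TwoForm M} (hvol : vol.IsPositiveContinuous)
    (h : HermitianMetric F E) (κ : HermitianMetric ℂ L) (D : Function.locallyFinsupp M ℤ)
    {w : ∀ x, L x} (hw : IsMeromorphicSection ℂ w) (hD : ∀ p, ordAt ℂ w p = (D p : ℤ))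
    {s : ∀ x, E x} (hs : s ∈ bergman ⊤ D.support (κ.weight w vol) h) (p : M) :
    ((-D) p : ℤ) ≤ ordAt F s p := by
  obtain ⟨g, hg, hge⟩ := exists_analyticAt_localRep_tmul hvol h κ D hw hD
    (fun p _ ↦ contMDiffAt_of_mem_holomorphicSections hs.1 trivial) hs.2 p
  have h1 := ordAt_nonneg_of_eventuallyEq hg hge
  rw [ordAt_tmul (meromorphicAt_of_mem hs.1 trivial) (hw p).1, hD] at h1
  exact WithTop.neg_coe_le_of_zero_le_coe_add h1

/-- Square integrability makes the product extend, and `ord t ≥ 0 ≥ D` makes the quotient extend.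
The formula for `Φ` is confined to the complement of the support, since the value of `w` at a pole
is arbitrary. -/
theorem exists_linearEquiv_bergman_of_nonpos {vol : TwoForm M} (hvol : vol.IsPositiveContinuous)
    (h : HermitianMetric F E) (κ : HermitianMetric ℂ L) (D : Function.locallyFinsupp M ℤ)
    {w : ∀ x, L x} (hw : IsMeromorphicSection ℂ w) (hD : ∀ p, ordAt ℂ w p = (D p : ℤ))
    (hD0 : D ≤ 0) :
    ∃ Φ : bergman ⊤ D.support (κ.weight w vol) h ≃ₗ[ℂ] bergman ⊤ ∅ vol (h.tensor κ),
      (∀ s, ∀ x ∉ D.support, (Φ s).1 x = TensorLine.tmul F (s.1 x) (w x)) ∧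
      ∀ s, l2Norm ⊤ ∅ vol (h.tensor κ) (Φ s).1 =
        l2Norm ⊤ D.support (κ.weight w vol) h s.1 := by
  have : CompleteSpace F := FiniteDimensional.complete ℂ F
  have hS := D.closedSupport isClosed_univ
  have hd := D.eventually_notMem_support
  have hwc : ∀ x ∉ D.support, _ := fun x hx ↦ hw.contMDiffAt_of_notMem hD hx
  have hw0 : ∀ x ∉ D.support, w x ≠ 0 := fun x hx ↦ hw.ne_zero_of_notMem hD hx
  have hiso : ∀ {s : ∀ x, E x} {t : ∀ x, TensorLine F E L x},
      (∀ x ∉ D.support, t x = TensorLine.tmul F (s x) (w x)) →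
      l2NormSq ⊤ ∅ vol (h.tensor κ) t = l2NormSq ⊤ D.support (κ.weight w vol) h s :=
    fun ht ↦ l2NormSq_tmul hvol h κ hS hd hwc hw0 ht
  obtain ⟨Φ, hΦ⟩ := Submodule.exists_linearEquiv_of_forall_mem
    (bergman ⊤ D.support (κ.weight w vol) h) (bergman ⊤ ∅ vol (h.tensor κ))
    (fun x ↦ TensorLine.tmulRight F E (w x)) D.supportᶜ
    (by
      intro s hs
      have hsc := fun p (_ : p ∉ D.support) ↦
        contMDiffAt_of_mem_holomorphicSections hs.1 (p := p) trivial
      obtain ⟨t, ht, hte⟩ := exists_holomorphicSections_of_analyticAt hS hd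
        (s₀ := fun x ↦ TensorLine.tmul F (s x) (w x))
        (fun p hp ↦ contMDiffAt_section_iff_analyticAt_localRep.1
          (contMDiffAt_tmul (hsc p hp) (hwc p hp)))
        (fun p _ ↦ exists_analyticAt_localRep_tmul hvol h κ D hw hD hsc hs.2 p)
      exact ⟨t, ⟨ht, (hiso hte).trans_lt hs.2⟩, hte⟩)
    (by
      intro t ht
      have htc := fun p ↦ contMDiffAt_of_mem_holomorphicSections ht.1 (p := p) trivial
      obtain ⟨s, hs, hse⟩ := exists_holomorphicSections_tmul_eq hS hd hw
        (fun p hp ↦ by rw [hD, Function.notMem_support.1 hp]; rfl)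
        (fun p ↦ by rw [hD]; exact WithTop.coe_ne_top) (fun p _ ↦ htc p)
        (fun p ↦ meromorphicAt_localRep (htc p)) (fun p ↦ by
          rw [hD]
          exact (WithTop.coe_le_coe.2 (hD0 p)).trans (ordAt_nonneg_of_contMDiffAt (htc p)))
      exact ⟨s, ⟨hs, (hiso hse).symm.trans_lt ht.2⟩, hse⟩)
    (fun t ht h0 ↦ eq_zero_of_mem_holomorphicSections hd ht.1 h0)
    (fun s hs h0 ↦ eq_zero_of_mem_holomorphicSections hd hs.1 fun x hx ↦
      TensorLine.tmul_eq_zero (hw0 x hx) (h0 x hx))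
  refine ⟨Φ, hΦ, fun s ↦ ?_⟩
  rw [l2Norm, l2Norm, hiso (hΦ s)]

/-- Now `w` is holomorphic, so the product needs no extension and the formula holds at every point;
the divisor condition on the target is precisely what permits division by `w`. -/
theorem exists_linearEquiv_bergmanDiv_of_nonneg {vol : TwoForm M}
    (hvol : vol.IsPositiveContinuous)
    (h : HermitianMetric F E) (κ : HermitianMetric ℂ L) (D : Function.locallyFinsupp M ℤ)
    {w : ∀ x, L x} (hw : IsMeromorphicSection ℂ w) (hD : ∀ p, ordAt ℂ w p = (D p : ℤ))
    (hD0 : 0 ≤ D) :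
    ∃ Φ : bergman ⊤ D.support (κ.weight w vol) h ≃ₗ[ℂ] bergmanDiv D ⊤ vol (h.tensor κ),
      (∀ s x, (Φ s).1 x = TensorLine.tmul F (s.1 x) (w x)) ∧
      ∀ s, l2Norm ⊤ ∅ vol (h.tensor κ) (Φ s).1 =
        l2Norm ⊤ D.support (κ.weight w vol) h s.1 := by
  have : CompleteSpace F := FiniteDimensional.complete ℂ F
  have hS := D.closedSupport isClosed_univ
  have hd := D.eventually_notMem_support
  have hwc : ∀ x, ContMDiffAt 𝓘(ℂ) (𝓘(ℂ).prod 𝓘(ℂ, ℂ)) ω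
      (fun x ↦ TotalSpace.mk' ℂ x (w x)) x := fun x ↦ (hw x).2 (by
    rw [hD]
    exact WithTop.coe_le_coe.2 (hD0 x))
  have hw0 : ∀ x ∉ D.support, w x ≠ 0 := fun x hx ↦ hw.ne_zero_of_notMem hD hx
  have hiso : ∀ {s : ∀ x, E x} {t : ∀ x, TensorLine F E L x},
      (∀ x ∉ D.support, t x = TensorLine.tmul F (s x) (w x)) →
      l2NormSq ⊤ ∅ vol (h.tensor κ) t = l2NormSq ⊤ D.support (κ.weight w vol) h s :=
    fun ht ↦ l2NormSq_tmul hvol h κ hS hd (fun x _ ↦ hwc x) hw0 ht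
  have hmul : ∀ {s : ∀ x, E x}, s ∈ holomorphicSections F E ⊤ →
      (fun x ↦ TensorLine.tmul F (s x) (w x)) ∈ holomorphicSections F (TensorLine F E L) ⊤ :=
    fun hs ↦ ⟨fun x hx ↦ absurd trivial hx, fun x _ ↦ (contMDiffAt_tmul
      (contMDiffAt_of_mem_holomorphicSections hs trivial) (hwc x)).contMDiffWithinAt⟩
  obtain ⟨Φ, hΦ⟩ := Submodule.exists_linearEquiv_of_forall_mem
    (bergman ⊤ D.support (κ.weight w vol) h) (bergmanDiv D ⊤ vol (h.tensor κ))
    (fun x ↦ TensorLine.tmulRight F E (w x)) Set.univ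
    (by
      intro s hs
      refine ⟨_, ⟨⟨hmul hs.1, (hiso fun x _ ↦ rfl).trans_lt hs.2⟩, fun p hp ↦ ?_⟩, fun x _ ↦ rfl⟩
      rw [ordAt_tmul (meromorphicAt_of_mem hs.1 trivial) (hw p).1, hD]
      exact le_add_of_nonneg_right
        (ordAt_nonneg_of_contMDiffAt (contMDiffAt_of_mem_holomorphicSections hs.1 trivial)))
    (by
      intro t ht
      have htc := fun p ↦ contMDiffAt_of_mem_holomorphicSections ht.1.1 (p := p) trivial
      obtain ⟨s, hs, hse⟩ := exists_holomorphicSections_tmul_eq hS hd hw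
        (fun p hp ↦ by rw [hD, Function.notMem_support.1 hp]; rfl)
        (fun p ↦ by rw [hD]; exact WithTop.coe_ne_top) (fun p _ ↦ htc p)
        (fun p ↦ meromorphicAt_localRep (htc p)) (fun p ↦ by
          rw [hD]
          exact ht.2 p trivial)
      refine ⟨s, ⟨hs, (hiso hse).symm.trans_lt ht.1.2⟩, fun x _ ↦ ?_⟩
      -- Division gives the identity only off the support; the identity theorem carries it to the
      -- zeros of `w`.
      have h0 := eq_zero_of_mem_holomorphicSections hd (sub_mem ht.1.1 (hmul hs)) fun x hx ↦ by
        rw [Pi.sub_apply, hse x hx, sub_self]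
      exact congrFun (sub_eq_zero.1 h0) x)
    (fun t ht h0 ↦ funext fun x ↦ h0 x trivial)
    (fun s hs h0 ↦ eq_zero_of_mem_holomorphicSections hd hs.1 fun x hx ↦
      TensorLine.tmul_eq_zero (hw0 x hx) (h0 x trivial))
  refine ⟨Φ, fun s x ↦ hΦ s x trivial, fun s ↦ ?_⟩
  rw [l2Norm, l2Norm, hiso fun x _ ↦ hΦ s x trivial]

/-- Multiplication by `sp` is isometric for the weights `κm(sm, sm)` and
`κp(sp, sp) κm(sm, sm)`. -/
theorem l2NormSq_complSupport_tmul {vol : TwoForm M} (hvol : vol.IsPositiveContinuous)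
    (h : HermitianMetric F E) (D : Function.locallyFinsupp M ℤ)
    {sp : ∀ x, Lp x} (hsp : IsMeromorphicSection ℂ sp)
    (hdivp : ∀ p, ordAt ℂ sp p = (D⁺ p : ℤ)) (κp : HermitianMetric ℂ Lp)
    {sm : ∀ x, Lm x} (hsm : IsMeromorphicSection ℂ sm)
    (hdivm : ∀ p, ordAt ℂ sm p = ((-D⁻) p : ℤ)) (κm : HermitianMetric ℂ Lm)
    {s : ∀ x, E x} {t : ∀ x, TensorLine F E Lp x}
    (ht : ∀ x ∉ D.support, t x = TensorLine.tmul F (s x) (sp x)) :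
    l2NormSq (complSupport D⁻) ∅ (κm.weight sm vol) (h.tensor κp) t =
      l2NormSq ⊤ D.support
        ((κp.tensor κm).weight (fun x ↦ TensorLine.tmul ℂ (sp x) (sm x)) vol) h s := by
  have hS := D.closedSupport isClosed_univ
  have hd := D.eventually_notMem_support
  have hSm := (D⁻).closedSupport isClosed_univ
  have hmD : (D⁻).support ⊆ D.support := fun x hx h0 ↦ hx (by
    rw [Function.locallyFinsuppWithin.negPart_apply, h0, negPart_zero])
  have hpD : (D⁺).support ⊆ D.support := fun x hx h0 ↦ hx (by
    rw [Function.locallyFinsuppWithin.posPart_apply, h0, posPart_zero])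
  have hneg : ∀ x, x ∉ (D⁻).support → x ∉ (-D⁻).support := fun x hx ↦ by simpa using hx
  have hspc : ∀ x ∉ D.support, _ := fun x hx ↦
    hsp.contMDiffAt_of_notMem hdivp fun h' ↦ hx (hpD h')
  have hsp0 : ∀ x ∉ D.support, sp x ≠ 0 := fun x hx ↦
    hsp.ne_zero_of_notMem hdivp fun h' ↦ hx (hpD h')
  have hsmc : ∀ x ∉ (D⁻).support, _ := fun x hx ↦ hsm.contMDiffAt_of_notMem hdivm (hneg x hx)
  have hsm0 : ∀ x ∉ (D⁻).support, sm x ≠ 0 := fun x hx ↦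
    hsm.ne_zero_of_notMem hdivm (hneg x hx)
  have hA : ((⊤ : Opens M) : Set M) \ D.support = D.supportᶜ := by
    simp [Set.compl_eq_univ_sdiff]
  have hA' : ((complSupport D⁻ : Opens M) : Set M) \ ∅ = (D⁻).supportᶜ := by
    rw [Set.sdiff_empty]
    rfl
  rw [l2NormSq, l2NormSq, hA, hA',
    show κm.weight sm vol = fun x ↦ κm.normSq x (sm x) • vol x from rfl,
    TwoForm.setLIntegral_smul hvol hSm (D⁻).eventually_notMem_support
      (κm.continuousOn_normSq_of_contMDiffAt hsmc) (fun x hx ↦ κm.normSq_pos (hsm0 x hx))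
      hSm.measurableSet.compl le_rfl,
    -- The two domains of integration differ by part of the null set `D.support`, namely the points
    -- where `D` is positive.
    setLIntegral_congr (compl_ae_eq_of_subset hS hd hmD),
    show (κp.tensor κm).weight (fun x ↦ TensorLine.tmul ℂ (sp x) (sm x)) vol =
      fun x ↦ (κp.normSq x (sp x) * κm.normSq x (sm x)) • vol x from funext fun x ↦ by
        rw [← HermitianMetric.normSq_tensor_tmul]; rfl,
    TwoForm.setLIntegral_smul hvol hS hd (g := fun x ↦ κp.normSq x (sp x) * κm.normSq x (sm x))
      ((κp.continuousOn_normSq_of_contMDiffAt hspc).mul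
        ((κm.continuousOn_normSq_of_contMDiffAt hsmc).mono (Set.compl_subset_compl.2 hmD)))
      (fun x hx ↦ mul_pos (κp.normSq_pos (hsp0 x hx)) (κm.normSq_pos (hsm0 x fun h' ↦ hx (hmD h'))))
      hS.measurableSet.compl le_rfl]
  refine setLIntegral_congr_fun hS.measurableSet.compl fun x hx ↦ ?_
  rw [ht x hx, h.normSq_tensor_tmul, ← ENNReal.ofReal_mul (κm.normSq_nonneg _ _),
    ← ENNReal.ofReal_mul (mul_nonneg (κp.normSq_nonneg _ _) (κm.normSq_nonneg _ _))]
  congr 1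
  ring

/-- Only surjectivity is new: a section given off the support of `D⁻` must, after division by `sp`,
extend across it. The weight of `sm` forces this, through removability for `t ⊗ sm`. -/
theorem exists_linearEquiv_bergmanDiv_complSupport {vol : TwoForm M}
    (hvol : vol.IsPositiveContinuous)
    (h : HermitianMetric F E) (D : Function.locallyFinsupp M ℤ)
    {sp : ∀ x, Lp x} (hsp : IsMeromorphicSection ℂ sp)
    (hdivp : ∀ p, ordAt ℂ sp p = (D⁺ p : ℤ)) (κp : HermitianMetric ℂ Lp)
    {sm : ∀ x, Lm x} (hsm : IsMeromorphicSection ℂ sm)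
    (hdivm : ∀ p, ordAt ℂ sm p = ((-D⁻) p : ℤ)) (κm : HermitianMetric ℂ Lm) :
    ∃ Φ : bergman ⊤ D.support
        ((κp.tensor κm).weight (fun x ↦ TensorLine.tmul ℂ (sp x) (sm x)) vol) h ≃ₗ[ℂ]
        bergmanDiv D⁺ (complSupport D⁻) (κm.weight sm vol) (h.tensor κp),
      (∀ s, ∀ x ∈ complSupport D⁻, (Φ s).1 x = TensorLine.tmul F (s.1 x) (sp x)) ∧
      ∀ s, l2Norm (complSupport D⁻) ∅ (κm.weight sm vol) (h.tensor κp) (Φ s).1 =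
        l2Norm ⊤ D.support
          ((κp.tensor κm).weight (fun x ↦ TensorLine.tmul ℂ (sp x) (sm x)) vol) h s.1 := by
  classical
  have : CompleteSpace F := FiniteDimensional.complete ℂ F
  have hS := D.closedSupport isClosed_univ
  have hd := D.eventually_notMem_support
  have hmD : (D⁻).support ⊆ D.support := fun x hx h0 ↦ hx (by
    rw [Function.locallyFinsuppWithin.negPart_apply, h0, negPart_zero])
  have hpD : (D⁺).support ⊆ D.support := fun x hx h0 ↦ hx (by
    rw [Function.locallyFinsuppWithin.posPart_apply, h0, posPart_zero])
  have hDU : ∀ x ∉ D.support, x ∈ complSupport D⁻ := fun x hx h' ↦ hx (hmD h')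
  have hspc : ∀ x, ContMDiffAt 𝓘(ℂ) (𝓘(ℂ).prod 𝓘(ℂ, ℂ)) ω
      (fun x ↦ TotalSpace.mk' ℂ x (sp x)) x := fun x ↦ (hsp x).2 (by
    rw [hdivp, Function.locallyFinsuppWithin.posPart_apply]
    exact WithTop.coe_le_coe.2 (posPart_nonneg _))
  have hsp0 : ∀ x ∉ D.support, sp x ≠ 0 := fun x hx ↦
    hsp.ne_zero_of_notMem hdivp fun h' ↦ hx (hpD h')
  have hiso : ∀ {s : ∀ x, E x} {t : ∀ x, TensorLine F E Lp x},
      (∀ x ∉ D.support, t x = TensorLine.tmul F (s x) (sp x)) →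
      l2NormSq (complSupport D⁻) ∅ (κm.weight sm vol) (h.tensor κp) t = l2NormSq ⊤ D.support
        ((κp.tensor κm).weight (fun x ↦ TensorLine.tmul ℂ (sp x) (sm x)) vol) h s :=
    fun ht ↦ l2NormSq_complSupport_tmul hvol h D hsp hdivp κp hsm hdivm κm ht
  obtain ⟨Φ, hΦ⟩ := Submodule.exists_linearEquiv_of_forall_mem
    (bergman ⊤ D.support
      ((κp.tensor κm).weight (fun x ↦ TensorLine.tmul ℂ (sp x) (sm x)) vol) h)
    (bergmanDiv D⁺ (complSupport D⁻) (κm.weight sm vol) (h.tensor κp))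
    (fun x ↦ TensorLine.tmulRight F E (sp x)) (complSupport D⁻)
    (by
      intro s hs
      let t : ∀ x, TensorLine F E Lp x := fun x ↦
        if x ∈ complSupport D⁻ then TensorLine.tmul F (s x) (sp x) else 0
      have ht : ∀ x ∈ complSupport D⁻, t x = TensorLine.tmul F (s x) (sp x) :=
        fun x hx ↦ if_pos hx
      have hte : ∀ p ∈ complSupport D⁻, ∀ᶠ x in 𝓝 p, TensorLine.tmul F (s x) (sp x) = t x :=
        fun p hp ↦ by
          filter_upwards [(complSupport D⁻).isOpen.mem_nhds hp] with x hx
          exact (ht x hx).symm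
      refine ⟨t, ⟨⟨⟨fun x hx ↦ if_neg hx, fun p hp ↦ ContMDiffAt.contMDiffWithinAt ?_⟩,
        (hiso fun x hx ↦ ht x (hDU x hx)).trans_lt hs.2⟩, fun p hp ↦ ?_⟩, ht⟩
      · rw [contMDiffAt_section_iff_analyticAt_localRep]
        exact (contMDiffAt_section_iff_analyticAt_localRep.1 (contMDiffAt_tmul
          (contMDiffAt_of_mem_holomorphicSections hs.1 trivial) (hspc p))).congr
          (localRep_congr (hte p hp))
      · rw [ordAt, ← meromorphicOrderAt_congr
          ((localRep_congr (hte p hp)).filter_mono nhdsWithin_le_nhds)]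
        change _ ≤ ordAt F (fun x ↦ TensorLine.tmul F (s x) (sp x)) p
        rw [ordAt_tmul (meromorphicAt_of_mem hs.1 trivial) (hsp p).1, hdivp]
        exact le_add_of_nonneg_right
          (ordAt_nonneg_of_contMDiffAt (contMDiffAt_of_mem_holomorphicSections hs.1 trivial)))
    (by
      intro t ht
      have htc := fun p (hp : p ∈ complSupport D⁻) ↦
        contMDiffAt_of_mem_holomorphicSections ht.1.1 hp
      -- At points of the support of `D⁻` the value of `t` is zero by convention, but meromorphy and
      -- order see only the punctured neighbourhood.
      have hboth : ∀ p, MeromorphicAt (localRep F t p) (chartAt ℂ p p) ∧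
          ordAt ℂ sp p ≤ ordAt F t p := by
        intro p
        rw [hdivp]
        by_cases hp : p ∈ complSupport D⁻
        · exact ⟨meromorphicAt_localRep (htc p hp), ht.2 p hp⟩
        have hDp : D⁻ p ≠ 0 := by
          by_contra h0
          exact hp fun h' ↦ h' h0
        have hsupp : (-D⁻).support = (D⁻).support := by
          rw [Function.locallyFinsuppWithin.support, Function.locallyFinsuppWithin.coe_neg,
            Function.support_neg]
        have hi : l2NormSq ⊤ (-D⁻).support (κm.weight sm vol) (h.tensor κp) t < ⊤ := by
          have hsub : ((⊤ : Opens M) : Set M) \ (-D⁻).support ⊆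
              ((complSupport D⁻ : Opens M) : Set M) \ ∅ := fun x hx ↦ by
            rw [hsupp] at hx
            exact ⟨hx.2, Set.notMem_empty x⟩
          exact (lintegral_mono_set hsub).trans_lt ht.1.2
        -- The extension result is applied to the bundle `E ⊗ Lp` and the divisor `-D⁻`; it asks for
        -- holomorphy of `t` only off that support.
        obtain ⟨g, hg, hge⟩ := exists_analyticAt_localRep_tmul hvol (h.tensor κp) κm (-D⁻) hsm
          hdivm (fun x hx ↦ htc x (by rwa [hsupp] at hx)) hi p
        have hsmtop : ordAt ℂ sm p ≠ ⊤ := by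
          rw [hdivm]
          exact WithTop.coe_ne_top
        -- Having finite order, `sm` does not vanish near `p` off `p`, so it can be divided out,
        -- which shows that `t` is meromorphic at `p`.
        have hinv : localRep F t p =ᶠ[𝓝[≠] (chartAt ℂ p p)] (localRep ℂ sm p)⁻¹ • g := by
          filter_upwards [hge, (localRep_tmul (F := F) t sm p).filter_mono nhdsWithin_le_nhds,
            ((meromorphicOrderAt_ne_top_iff_eventually_ne_zero (hsm p).1).1 hsmtop)]
            with z h1 h2 h3
          rw [Pi.smul_apply', Pi.inv_apply, ← h1, h2, Pi.smul_apply', inv_smul_smul₀ h3]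
        have htm : MeromorphicAt (localRep F t p) (chartAt ℂ p p) :=
          ((hsm p).1.inv.smul hg.meromorphicAt).congr hinv.symm
        refine ⟨htm, ?_⟩
        have h1 := ordAt_nonneg_of_eventuallyEq hg hge
        rw [ordAt_tmul htm (hsm p).1, hdivm] at h1
        -- Nonnegative order of `t ⊗ sm` means `ord t ≥ D⁻ p`; since `D p < 0`, also `D⁺ p = 0 ≤ D⁻
        -- p`.
        refine le_trans (WithTop.coe_le_coe.2 ?_) (WithTop.neg_coe_le_of_zero_le_coe_add h1)
        have h2 : D p < 0 := by
          by_contra h3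
          exact hDp (by
            rw [Function.locallyFinsuppWithin.negPart_apply, negPart_eq_zero.2 (not_lt.1 h3)])
        simp only [Function.locallyFinsuppWithin.posPart_apply,
          Function.locallyFinsuppWithin.coe_neg, Pi.neg_apply, neg_neg,
          Function.locallyFinsuppWithin.negPart_apply]
        rw [posPart_eq_zero.2 h2.le]
        exact negPart_nonneg _
      obtain ⟨s, hs, hse⟩ := exists_holomorphicSections_tmul_eq hS hd hsp
        (fun p hp ↦ by rw [hdivp, Function.notMem_support.1 fun h' ↦ hp (hpD h')]; rfl)
        (fun p ↦ by rw [hdivp]; exact WithTop.coe_ne_top) (fun p hp ↦ htc p (hDU p hp))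
        (fun p ↦ (hboth p).1) (fun p ↦ (hboth p).2)
      refine ⟨s, ⟨hs, (hiso hse).symm.trans_lt ht.1.2⟩, fun x hx ↦ sub_eq_zero.1 ?_⟩
      have hmul := contMDiffAt_tmul (contMDiffAt_of_mem_holomorphicSections hs (p := x) trivial)
        (hspc x)
      -- The identity, known off `D.support`, passes by continuity to the zeros of `sp`.
      refine eq_zero_of_eventually_punctured
        (s := fun x ↦ t x - TensorLine.tmulRight F E (sp x) (s x))
        ((htc x hx).sub_section hmul) ((hd x).mono fun y hy ↦ ?_)
      rw [hse y hy]
      exact sub_self _)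
    (fun t ht h0 ↦ funext fun x ↦ by
      by_cases hx : x ∈ complSupport D⁻
      · exact h0 x hx
      · exact ht.1.1.1 x hx)
    (fun s hs h0 ↦ eq_zero_of_mem_holomorphicSections hd hs.1 fun x hx ↦
      TensorLine.tmul_eq_zero (hsp0 x hx) (h0 x (hDU x hx)))
  refine ⟨Φ, hΦ, fun s ↦ ?_⟩
  rw [l2Norm, l2Norm, hiso fun x hx ↦ hΦ s x (hDU x hx)]

end BergmanIsometries

theorem mainTheorem8
    -- a Riemann surface `M` with a positive continuous volume form `vol`
    {M : Type*} [TopologicalSpace M] [T2Space M] [ChartedSpace ℂ M] [IsManifold 𝓘(ℂ) ω M]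
    [MeasurableSpace M] [BorelSpace M]
    (vol : TwoForm M) (hvol : vol.IsPositiveContinuous)
    -- a holomorphic vector bundle `E` with a continuous Hermitian metric `h`
    {F : Type*} [NormedAddCommGroup F] [NormedSpace ℂ F] [FiniteDimensional ℂ F]
    {E : M → Type*} [∀ x, AddCommGroup (E x)] [∀ x, Module ℂ (E x)]
    [TopologicalSpace (TotalSpace F E)] [∀ x, TopologicalSpace (E x)]
    [FiberBundle F E] [VectorBundle ℂ F E] [ContMDiffVectorBundle ω F E 𝓘(ℂ)]
    (h : HermitianMetric F E)
    -- a divisor `D`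
    (D : Function.locallyFinsupp M ℤ)
    -- the line bundle `L = L_D`, its section `sD` with divisor `D`, and a metric `κ` on it
    {L : M → Type*} [∀ x, AddCommGroup (L x)] [∀ x, Module ℂ (L x)]
    [TopologicalSpace (TotalSpace ℂ L)] [∀ x, TopologicalSpace (L x)]
    [FiberBundle ℂ L] [VectorBundle ℂ ℂ L] [ContMDiffVectorBundle ω ℂ L 𝓘(ℂ)]
    (sD : ∀ x, L x) (hsD : IsMeromorphicSection ℂ sD) (hdiv : ∀ p, ordAt ℂ sD p = (D p : ℤ))
    (κ : HermitianMetric ℂ L)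
    -- the same data for the positive part `D₊ = D⁺` of `D`
    {Lp : M → Type*} [∀ x, AddCommGroup (Lp x)] [∀ x, Module ℂ (Lp x)]
    [TopologicalSpace (TotalSpace ℂ Lp)] [∀ x, TopologicalSpace (Lp x)]
    [FiberBundle ℂ Lp] [VectorBundle ℂ ℂ Lp] [ContMDiffVectorBundle ω ℂ Lp 𝓘(ℂ)]
    (sp : ∀ x, Lp x) (hsp : IsMeromorphicSection ℂ sp)
    (hdivp : ∀ p, ordAt ℂ sp p = (D⁺ p : ℤ)) (κp : HermitianMetric ℂ Lp)
    -- the same data for the (nonpositive) negative part `D₋ = -D⁻` of `D`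
    {Lm : M → Type*} [∀ x, AddCommGroup (Lm x)] [∀ x, Module ℂ (Lm x)]
    [TopologicalSpace (TotalSpace ℂ Lm)] [∀ x, TopologicalSpace (Lm x)]
    [FiberBundle ℂ Lm] [VectorBundle ℂ ℂ Lm] [ContMDiffVectorBundle ω ℂ Lm 𝓘(ℂ)]
    (sm : ∀ x, Lm x) (hsm : IsMeromorphicSection ℂ sm)
    (hdivm : ∀ p, ordAt ℂ sm p = ((-D⁻) p : ℤ)) (κm : HermitianMetric ℂ Lm) :
    -- `D ≤ 0`, with `ρ_D = κ(sD, sD) vol`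
    (D ≤ 0 →
      (∀ s ∈ bergman ⊤ D.support (κ.weight sD vol) h,
        ∀ p, ((-D) p : ℤ) ≤ ordAt F s p) ∧
      ∃ Φ : bergman ⊤ D.support (κ.weight sD vol) h ≃ₗ[ℂ]
          bergman ⊤ ∅ vol (h.tensor κ),
        (∀ s, ∀ x ∉ D.support, (Φ s).1 x = TensorLine.tmul F (s.1 x) (sD x)) ∧
        ∀ s, l2Norm ⊤ ∅ vol (h.tensor κ) (Φ s).1 =
          l2Norm ⊤ D.support (κ.weight sD vol) h s.1) ∧
    -- `D ≥ 0`, with `ρ_D = κ(sD, sD) vol`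
    (0 ≤ D →
      ∃ Φ : bergman ⊤ D.support (κ.weight sD vol) h ≃ₗ[ℂ]
          bergmanDiv D ⊤ vol (h.tensor κ),
        (∀ s x, (Φ s).1 x = TensorLine.tmul F (s.1 x) (sD x)) ∧
        ∀ s, l2Norm ⊤ ∅ vol (h.tensor κ) (Φ s).1 =
          l2Norm ⊤ D.support (κ.weight sD vol) h s.1) ∧
    -- arbitrary `D`, with `ρ_D = (κ₊ ⊗ κ₋)(s₊ ⊗ s₋, s₊ ⊗ s₋) vol`
    (∃ Φ : bergman ⊤ D.support
          ((κp.tensor κm).weight (fun x ↦ TensorLine.tmul ℂ (sp x) (sm x)) vol) h ≃ₗ[ℂ]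
          bergmanDiv D⁺ (complSupport D⁻) (κm.weight sm vol) (h.tensor κp),
      (∀ s, ∀ x ∈ complSupport D⁻, (Φ s).1 x = TensorLine.tmul F (s.1 x) (sp x)) ∧
      ∀ s, l2Norm (complSupport D⁻) ∅ (κm.weight sm vol) (h.tensor κp) (Φ s).1 =
        l2Norm ⊤ D.support
          ((κp.tensor κm).weight (fun x ↦ TensorLine.tmul ℂ (sp x) (sm x)) vol) h s.1) := by
  refine ⟨fun hD ↦ ⟨fun s hs p ↦ ?_, ?_⟩, fun hD ↦ ?_, ?_⟩
  · exact neg_le_ordAt_of_mem_bergman hvol h κ D hsD hdiv hs p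
  · exact exists_linearEquiv_bergman_of_nonpos hvol h κ D hsD hdiv hD
  · exact exists_linearEquiv_bergmanDiv_of_nonneg hvol h κ D hsD hdiv hD
  · exact exists_linearEquiv_bergmanDiv_complSupport hvol h D hsp hdivp κp hsm hdivm κm
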